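/- Fix an integer $r\ge 2$ and consider the class of $r$th order general Burgers--Korteweg--de Vries equations $$u_t+C(t,x)\,u\,u_x=\sum_{k=0}^r A^k(t,x)\,u_k+B(t,x),\qquad u_k=\partial^k u/\partial x^k, \tag{1}$$ where the tuple of arbitrary elements $\theta=(A^0,\dots,A^r,B,C)$ runs through the tuples of smooth real functions of $(t,x)$, defined on open subsets of $\mathbb R^2$, with $CA^r\ne0$ everywhere. Denote by $\mathcal L_\theta\subset J^r$ the equation with coefficients $\theta$, viewed as a subset of the space of $r$-jets of functions $u(t,x)$. A (local) point transformation is a smooth injective map with nondegenerate differential on an open set. An admissible transformation is a triple $(\theta,\tilde\theta,\varphi)$, where $\varphi$ is a point transformation with an open domain $W$ in the $(t,x,u)$-space, $\theta$ and $\tilde\theta$ are arbitrary-element tuples on the projections of $W$ and $\varphi(W)$ to the plane of independent variables, and $\varphi$ maps $\mathcal L_\theta$ to $\mathcal L_{\tilde\theta}$, i.e., a jet in the domain of the $r$th prolongation of $\varphi$ belongs to $\mathcal L_\theta$ if and only if its image belongs to $\mathcal L_{\tilde\theta}$. These triples constitute the equivalence groupoid. A usual equivalence transformation over $W$ is a point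 transformation $\Phi$ in the joint space of $(t,x,u,\theta)$, defined for $(t,x,u)\in W$ and all values of $\theta$ with $CA^r\neq0$, that projects to a point transformation $\varphi=\pi_*\Phi$ of $(t,x,u)$ and maps each $\theta$, given over any open part $V$ of $W$, to a tuple $\tilde\theta=\Phi\theta$ of the class for which $(\theta,\tilde\theta,\varphi|_V)$ is admissible. These transformations constitute the usual equivalence group $G^\sim$. All transformations being local, they are considered below on convex open parts of their domains. **Theorem.** 1. The class (1) is normalized in the usual sense: the equivalence groupoid coincides with the subgroupoid induced by $G^\sim$. That is, for every point transformation $\varphi$ with open domain $W$ and every $\theta,\tilde\theta$, the triple $(\theta,\tilde\theta,\varphi)$ is admissible if and only if, for each convex open $V\subseteq W$, $\theta$ is an arbitrary-element tuple over $V$ and there is a usual equivalence transformation $\Phi$ over $V$ with $\pi_*\Phi=\varphi|_V$ and $\Phi\theta=\tilde\theta$ over $V$. 2. The usual equivalence group consists of the transformations in the joint space of $(t,x,u,\theta)$ whose $(t,x,u)$-components are of the form $$\tilde t=T(t),\qquad \tilde x=X(t,x),\qquad \tilde u=U^1(t)\,u+U^0(t,x), \tag{2}$$ where $T,X,U^1,U^0$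 are arbitrary smooth functions of their arguments with $T_tX_xU^1\ne0$. That is, on every convex open part of its domain, each usual equivalence transformation has $(t,x,u)$-components of the form (2); and conversely, for every convex open set $V$ and all such functions $T,X,U^1,U^0$ (smooth on the relevant projections of $V$, with $T_tX_xU^1\neq0$ there), the transformation (2) on $V$ extends to the arbitrary elements, in exactly one way, to a usual equivalence transformation over $V$. -/

import Mathlib

open Set Filter Topology
open scoped ContDiff

noncomputable section

namespace BurgersKdV

/-- The space of the independent variables `(t, x)`. -/
abbrev Base : Type := ℝ × ℝ

/-- The space of the equation variables `((t, x), u)`. -/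
abbrev Total : Type := Base × ℝ

/-- The space of values of the tuple of arbitrary elements `θ = (A⁰, …, Aʳ, B, C)`, written as
`(A, B, C)` with `A : Fin (r + 1) → ℝ`. -/
abbrev Coeffs (r : ℕ) : Type := (Fin (r + 1) → ℝ) × ℝ × ℝ

/-- The coefficient `Aᵏ`. -/
def Coeffs.A {r : ℕ} (c : Coeffs r) (k : Fin (r + 1)) : ℝ := c.1 k

/-- The coefficient `B`. -/
def Coeffs.B {r : ℕ} (c : Coeffs r) : ℝ := c.2.1

/-- The coefficient `C`. -/
def Coeffs.C {r : ℕ} (c : Coeffs r) : ℝ := c.2.2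

/-- The values allowed by the auxiliary inequality `C Aʳ ≠ 0`. -/
def regular (r : ℕ) : Set (Coeffs r) := {c | c.C * c.A (Fin.last r) ≠ 0}

/-- `θ` is, on the domain `Ω` of the `(t, x)`-plane, a tuple of arbitrary elements of the class:
its components are smooth functions of `(t, x)` and `C Aʳ ≠ 0`. Values outside `Ω` are ignored. -/
def IsArbitraryElement (r : ℕ) (Ω : Set Base) (θ : Base → Coeffs r) : Prop :=
  ContDiffOn ℝ ∞ θ Ω ∧ ∀ b ∈ Ω, θ b ∈ regular r

/-! ### Jets and equations -/

/-- The jet space `Jʳ` of functions `u(t, x)`: a jet consists of the point `(t, x)` and of the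
values of the derivatives `∂^(m+n) u / ∂tᵐ∂xⁿ` with `m + n ≤ r`. -/
abbrev JetSpace (r : ℕ) : Type := Base × ({α : ℕ × ℕ // α.1 + α.2 ≤ r} → ℝ)

/-- The jet coordinate that stands for `∂^(m+n) u / ∂tᵐ∂xⁿ` (zero by convention above order `r`). -/
def JetSpace.coord {r : ℕ} (j : JetSpace r) (m n : ℕ) : ℝ :=
  if h : m + n ≤ r then j.2 ⟨(m, n), h⟩ else 0

/-- The `r`-jet of the function `f` at the point `b = (t, x)`. -/
def jet (r : ℕ) (f : Base → ℝ) (b : Base) : JetSpace r :=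
  (b, fun α =>
    iteratedDeriv α.1.1 (fun s => iteratedDeriv α.1.2 (fun y => f (s, y)) b.2) b.1)

/-- The equation `u_t + C u u_x = ∑ₖ Aᵏ u_k + B` with the coefficients `θ`, as a subset of the jet
space `Jʳ`. -/
def equation (r : ℕ) (θ : Base → Coeffs r) : Set (JetSpace r) :=
  {j | j.coord 1 0 + (θ j.1).C * j.coord 0 0 * j.coord 0 1
      = ∑ k : Fin (r + 1), (θ j.1).A k * j.coord 0 (k : ℕ) + (θ j.1).B}

/-! ### Point transformations and admissible transformations -/

/-- `φ` is a (local) point transformation with domain `W`: a smooth injective map with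
nondegenerate differential on the open set `W`. Values outside `W` are ignored. -/
def IsPointTransformation {E : Type*} [NormedAddCommGroup E] [NormedSpace ℝ E]
    (W : Set E) (φ : E → E) : Prop :=
  IsOpen W ∧ ContDiffOn ℝ ∞ φ W ∧ InjOn φ W ∧ ∀ p ∈ W, (fderiv ℝ φ p).IsInvertible

/-- The `r`th prolongation of the point transformation `φ` with domain `W`, as a relation between
jets: it sends the jet of a function `f` to the jet of a function `g` at the corresponding points
if `φ` maps the graph of `f` to the graph of `g` there. (Every jet is the jet of a smooth function
on the whole plane.) -/
def Prolongs (r : ℕ) (W : Set Total) (φ : Total → Total) (j j' : JetSpace r) : Prop :=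
  ∃ (f g : Base → ℝ) (b : Base), ContDiff ℝ ∞ f ∧ ContDiff ℝ ∞ g ∧ (b, f b) ∈ W ∧
    (∀ᶠ a in 𝓝 b, (φ (a, f a)).2 = g (φ (a, f a)).1) ∧
    j = jet r f b ∧ j' = jet r g (φ (b, f b)).1

/-- The point transformation `φ` with domain `W` maps the equation with coefficients `θ` to the
equation with coefficients `θ'`: so does its prolongation with the corresponding subsets of the
jet space. -/
def MapsEquation (r : ℕ) (W : Set Total) (φ : Total → Total) (θ θ' : Base → Coeffs r) : Prop :=
  ∀ j j' : JetSpace r, Prolongs r W φ j j' → (j ∈ equation r θ ↔ j' ∈ equation r θ')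

/-- `(θ, θ', φ)` is an admissible transformation of the class, `φ` having the domain `W`; the
coefficients `θ` and `θ'` are defined on the projections of `W` and of `φ(W)` to the plane of the
independent variables. These triples constitute the equivalence groupoid. -/
def IsAdmissible (r : ℕ) (W : Set Total) (θ θ' : Base → Coeffs r) (φ : Total → Total) : Prop :=
  IsPointTransformation W φ ∧
  IsArbitraryElement r (Prod.fst '' W) θ ∧
  IsArbitraryElement r (Prod.fst '' (φ '' W)) θ' ∧
  MapsEquation r W φ θ θ'

/-! ### Usual equivalence transformations -/

/-- `Φ` carries `θ` to `θ'` over `W`: it maps the graph of `θ`, as a subset of the joint space of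
`(t, x, u, θ)`, to the graph of `θ'`, its `(t, x, u)`-component being `φ`. -/
def Carries {r : ℕ} (W : Set Total) (φ : Total → Total)
    (Φ : Total × Coeffs r → Total × Coeffs r) (θ θ' : Base → Coeffs r) : Prop :=
  ∀ p ∈ W, Φ (p, θ p.1) = (φ p, θ' (φ p).1)

/-- `Φ` is a usual equivalence transformation of the class over the domain `W`, with
`(t, x, u)`-component `φ`: a point transformation of the joint space of `(t, x, u, θ)`, defined
for `(t, x, u) ∈ W` and all values of `θ` with `C Aʳ ≠ 0`, which is projectable to the
`(t, x, u)`-space, with the projection `φ`, and maps every equation of the class (over any part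
`V` of the domain) to an equation of the class. -/
def IsEquivalenceTransformation (r : ℕ) (W : Set Total) (φ : Total → Total)
    (Φ : Total × Coeffs r → Total × Coeffs r) : Prop :=
  IsPointTransformation W φ ∧
  IsPointTransformation (W ×ˢ regular r) Φ ∧
  (∀ p ∈ W, ∀ c ∈ regular r, (Φ (p, c)).1 = φ p) ∧
  ∀ V : Set Total, IsOpen V → V ⊆ W → ∀ θ : Base → Coeffs r,
    IsArbitraryElement r (Prod.fst '' V) θ →
      ∃ θ' : Base → Coeffs r, IsAdmissible r V θ θ' φ ∧ Carries V φ Φ θ θ'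

/-- `(θ, θ', φ)`, with `φ` over the domain `W`, belongs to the subgroupoid induced by the usual
equivalence group: `φ = π_* Φ` and `θ' = Φ θ` for a usual equivalence transformation `Φ`. -/
def IsInduced (r : ℕ) (W : Set Total) (θ θ' : Base → Coeffs r) (φ : Total → Total) : Prop :=
  IsArbitraryElement r (Prod.fst '' W) θ ∧
  ∃ Φ : Total × Coeffs r → Total × Coeffs r,
    IsEquivalenceTransformation r W φ Φ ∧ Carries W φ Φ θ θ'

/-- The class is normalized in the usual sense: its equivalence groupoid coincides with the
subgroupoid induced by its usual equivalence group. Transformations being local, they are compared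
on all convex open parts of their domains (over a domain with disconnected fibres, a point
transformation may be glued from unrelated pieces). -/
def IsNormalizedInUsualSense (r : ℕ) : Prop :=
  ∀ (W : Set Total) (φ : Total → Total), IsPointTransformation W φ →
    ∀ θ θ' : Base → Coeffs r,
      IsAdmissible r W θ θ' φ ↔
        ∀ V : Set Total, IsOpen V → Convex ℝ V → V ⊆ W → IsInduced r V θ θ' φ

/-! ### The transformations of the theorem -/

/-- The map `t̃ = T(t)`, `x̃ = X(t, x)`, `ũ = U¹(t) u + U⁰(t, x)`. -/
def fiberAffine (T : ℝ → ℝ) (X : Base → ℝ) (U1 : ℝ → ℝ) (U0 : Base → ℝ) (p : Total) : Total :=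
  ((T p.1.1, X p.1), U1 p.1.1 * p.2 + U0 p.1)

/-- The parameter functions `T`, `X`, `U¹`, `U⁰` are smooth on the relevant projections of the
domain `V`, and `T_t X_x U¹ ≠ 0` there. -/
def AreParameters (V : Set Total) (T : ℝ → ℝ) (X : Base → ℝ) (U1 : ℝ → ℝ) (U0 : Base → ℝ) :
    Prop :=
  ContDiffOn ℝ ∞ T ((fun p : Total => p.1.1) '' V) ∧
  ContDiffOn ℝ ∞ X (Prod.fst '' V) ∧
  ContDiffOn ℝ ∞ U1 ((fun p : Total => p.1.1) '' V) ∧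
  ContDiffOn ℝ ∞ U0 (Prod.fst '' V) ∧
  ∀ p ∈ V, deriv T p.1.1 * deriv (fun y => X (p.1.1, y)) p.1.2 * U1 p.1.1 ≠ 0

end BurgersKdV

end

namespace BurgersKdV

/-! The argument compares exact solution jets. Choose smooth functions through the same point that
satisfy the source equation there; their images under `φ` are functions `g` that satisfy the target
equation at the image point. Once the factor `u` in front of `u_x` is frozen the equation is linear
(`linearPart`), so suitable differences `G` of the `g` are annihilated by the linear part. If all
`x`-derivatives of `G` of order below `r` vanish, only `G_t = Aʳ ∂ₓʳ G` (target coefficient)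
remains. The leading behaviour of `G` is computed from `φ` and from the chosen source functions, so
this relation is a constraint on `φ`.

Varying the source functions gives the constraints one at a time. Adding `(t - t₀)ʳ` leaves the
source condition unchanged, but would produce a nonzero `∂ₓʳ G` if `T` depended on `x` or `u`
(`IsAdmissible.fst_fst_eq_zero`). Trading `(x - x₀)ʳ` against `t - t₀` yields `T_t Ãʳ = Aʳ (D_x
X)ʳ`; since `r ≥ 2`, the right side would vary with the free value `u_x` unless `X_u = 0`
(`IsAdmissible.leading_coeff_eq`, `IsAdmissible.X_u_eq_zero`). A mixed second difference in
multiples of `x - x₀` and `(x - x₀)ʳ⁻¹` isolates `U_uu = 0` (`IsAdmissible.U_uu_eq_zero`). Finally a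
second difference in the value `u` isolates the quadratic term `C u u_x` and, as `C ≠ 0`, makes the
coefficient of `u` independent of `x` (`IsAdmissible.U1_x_eq_zero`). Convexity turns these
infinitesimal statements into the form (2).

Conversely, for a map of the form (2) the chain rule expresses the new coefficients through the old
ones by an explicit affine formula `pushCoeffs`, under which the residuals of the two equations are
proportional (`linearPart_pushCoeffs`). The formula is smooth and injective, hence an equivalence
transformation. The target coefficients are determined by the set of solution jets over two values
of `u` (`coeffs_eq_of_linearPart_iff`), which gives uniqueness of the extension and identifies every
admissible transformation with an induced one. -/

/-! ### Analytic preliminaries: cut-offs, local inverses, Taylor coefficients. -/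

theorem isInvertible_of_injective {E : Type*} [NormedAddCommGroup E] [NormedSpace ℝ E]
    [FiniteDimensional ℝ E] {L : E →L[ℝ] E} (h : ∀ v, L v = 0 → v = 0) : L.IsInvertible := by
  have hi : Function.Injective L.toLinearMap := by
    rw [injective_iff_map_eq_zero]
    exact h
  exact ⟨(LinearEquiv.ofInjectiveEndo L.toLinearMap hi).toContinuousLinearEquiv, by ext; simp⟩

/-- Multiply by a bump function. Prolongation is defined through globally smooth functions, whereas
images of graphs are only locally graphs. -/
theorem exists_contDiff_eventuallyEq {E : Type*} [NormedAddCommGroup E] [NormedSpace ℝ E]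
    [FiniteDimensional ℝ E] {N : Set E} {g₀ : E → ℝ} {q : E} (hN : IsOpen N) (hq : q ∈ N)
    (hg : ContDiffOn ℝ ∞ g₀ N) : ∃ g : E → ℝ, ContDiff ℝ ∞ g ∧ g =ᶠ[𝓝 q] g₀ := by
  obtain ⟨ε, hε, hεN⟩ := Metric.isOpen_iff.1 hN q hq
  let b : ContDiffBump q := ⟨ε / 4, ε / 2, by positivity, by linarith⟩
  refine ⟨fun x => b x * g₀ x, ?_, ?_⟩
  · rw [contDiff_iff_contDiffAt]
    intro x
    by_cases hx : x ∈ Metric.ball q ε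
    · exact b.contDiff.contDiffAt.mul (hg.contDiffAt (hN.mem_nhds (hεN hx)))
    · have : (fun x => b x * g₀ x) =ᶠ[𝓝 x] fun _ => 0 := by
        have hx' : x ∈ (Metric.closedBall q (ε / 2))ᶜ := by
          simp only [Metric.mem_ball, not_lt, mem_compl_iff, Metric.mem_closedBall, not_le] at *
          linarith
        filter_upwards [Metric.isClosed_closedBall.isOpen_compl.mem_nhds hx'] with y hy
        rw [b.zero_of_le_dist, zero_mul]
        simp only [mem_compl_iff, Metric.mem_closedBall, not_le] at hy
        exact hy.le
      exact contDiffAt_const.congr_of_eventuallyEq this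
  · filter_upwards [b.eventuallyEq_one] with y hy
    simp [hy]

/-- Inverse function theorem, with the target shrunk to points whose preimage has an invertible
differential, so that the inverse is smooth on a whole neighbourhood. -/
theorem exists_contDiffOn_localInverse {E : Type*} [NormedAddCommGroup E] [NormedSpace ℝ E]
    [CompleteSpace E] {O : Set E} {ψ : E → E} {b : E} (hO : IsOpen O) (hb : b ∈ O)
    (hψ : ContDiffOn ℝ ∞ ψ O) (hinv : (fderiv ℝ ψ b).IsInvertible) :
    ∃ (N : Set E) (χ : E → E), IsOpen N ∧ ψ b ∈ N ∧ ContDiffOn ℝ ∞ χ N ∧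
      (∀ q ∈ N, χ q ∈ O ∧ ψ (χ q) = q) ∧ ∀ᶠ a in 𝓝 b, χ (ψ a) = a := by
  obtain ⟨e', he'⟩ := hinv
  have hd : ∀ x ∈ O, DifferentiableAt ℝ ψ x := fun x hx =>
    (hψ.contDiffAt (hO.mem_nhds hx)).differentiableAt (by simp)
  have h1 : HasFDerivAt ψ (e' : E →L[ℝ] E) b := by
    rw [he']; exact (hd b hb).hasFDerivAt
  have hc := hψ.contDiffAt (hO.mem_nhds hb)
  let e := hc.toOpenPartialHomeomorph ψ h1 (by simp)
  have hbe : b ∈ e.source := hc.mem_toOpenPartialHomeomorph_source h1 (by simp)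
  have hcont : ContinuousOn (fderiv ℝ ψ) O := hψ.continuousOn_fderiv_of_isOpen hO (by simp)
  let O' := O ∩ fderiv ℝ ψ ⁻¹' range ((↑) : (E ≃L[ℝ] E) → E →L[ℝ] E)
  have hO' : IsOpen O' := hcont.isOpen_inter_preimage hO ContinuousLinearEquiv.isOpen
  refine ⟨e.target ∩ e.symm ⁻¹' O', e.symm, e.isOpen_inter_preimage_symm hO', ?_, ?_, ?_, ?_⟩
  · refine ⟨e.map_source hbe, ?_⟩
    change e.symm (e b) ∈ O'
    rw [e.left_inv hbe]
    exact ⟨hb, e', he'⟩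
  · rintro q ⟨hq, hqO, d, hdq⟩
    refine ContDiffAt.contDiffWithinAt (e.contDiffAt_symm (f₀' := d) hq ?_ ?_)
    · rw [hdq]; exact (hd _ hqO).hasFDerivAt
    · exact hψ.contDiffAt (hO.mem_nhds hqO)
  · rintro q ⟨hq, hqO, -⟩
    exact ⟨hqO, e.right_inv hq⟩
  · filter_upwards [e.open_source.mem_nhds hbe] with a ha using e.left_inv ha

/-- By strong induction the Taylor polynomial of order `k` reduces to its top term; dividing by `s ^
k` and letting `s → 0` kills that term, because `ξ` has nonzero speed. -/
theorem iteratedDeriv_eq_zero_of_isLittleO {h ξ : ℝ → ℝ} {D : ℝ} {r : ℕ} (hh : ContDiff ℝ ∞ h)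
    (hξ : HasDerivAt ξ D 0) (hD : D ≠ 0)
    (ho : (fun s => h (ξ s)) =o[𝓝 0] fun s : ℝ => s ^ r) :
    ∀ k ≤ r, iteratedDeriv k h (ξ 0) = 0 := by
  intro k
  induction k using Nat.strong_induction_on with
  | _ k ih =>
  intro hk
  have hξc : Tendsto ξ (𝓝 0) (𝓝 (ξ 0)) := hξ.continuousAt
  have hlin : (fun s => ξ s - ξ 0) =O[𝓝 0] fun s : ℝ => s := by
    simpa using hξ.differentiableAt.isBigO_sub
  have h1 : (fun x => h x - taylorWithinEval h k univ (ξ 0) x) =o[𝓝 (ξ 0)]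
      fun x => (x - ξ 0) ^ k :=
    taylor_isLittleO_univ (hh.of_le (by exact_mod_cast le_top))
  have h2 := (h1.comp_tendsto hξc).trans_isBigO (hlin.pow k)
  have h3 : (fun s => h (ξ s)) =o[𝓝 0] fun s : ℝ => s ^ k :=
    ho.trans_isBigO <| .of_bound 1 <| by
      filter_upwards [Metric.ball_mem_nhds (0 : ℝ) one_pos] with s hs
      have hs' : |s| ≤ 1 := by simpa using (Metric.mem_ball.1 hs).le
      simpa using pow_le_pow_of_le_one (abs_nonneg s) hs' hk
  have h4 : ∀ x, taylorWithinEval h k univ (ξ 0) x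
      = iteratedDeriv k h (ξ 0) / k.factorial * (x - ξ 0) ^ k := by
    intro x
    rw [taylor_within_apply, Finset.sum_range_succ, Finset.sum_eq_zero, zero_add]
    · rw [iteratedDerivWithin_univ, smul_eq_mul]; ring
    · intro j hj
      rw [iteratedDerivWithin_univ, ih j (Finset.mem_range.1 hj)
        ((Finset.mem_range.1 hj).le.trans hk), smul_zero]
  have h5 : (fun s => iteratedDeriv k h (ξ 0) / k.factorial * (ξ s - ξ 0) ^ k)
      =o[𝓝 0] fun s : ℝ => s ^ k := by
    refine (h3.sub h2).congr_left fun s => ?_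
    simp [h4]
  have h6 : Tendsto (fun s => iteratedDeriv k h (ξ 0) / k.factorial * ((ξ s - ξ 0) / s) ^ k)
      (𝓝[≠] 0) (𝓝 (iteratedDeriv k h (ξ 0) / k.factorial * D ^ k)) := by
    have := hasDerivAt_iff_tendsto_slope_zero.1 hξ
    refine ((this.pow k).const_mul _).congr fun s => ?_
    simp [div_eq_inv_mul]
  have h7 := (h5.mono nhdsWithin_le_nhds (l := 𝓝[≠] 0)).tendsto_div_nhds_zero
  have h8 := tendsto_nhds_unique h6 (h7.congr fun s => by rw [div_pow, mul_div_assoc])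
  have hf : (k.factorial : ℝ) ≠ 0 := by positivity
  have := pow_ne_zero k hD
  simp_all

theorem pow_sub_isLittleO {ξ : ℝ → ℝ} {D : ℝ} (hξ : HasDerivAt ξ D 0) (r : ℕ) :
    (fun s => (ξ s - ξ 0) ^ r - D ^ r * s ^ r) =o[𝓝 0] fun s : ℝ => s ^ r := by
  have h6 : Tendsto (fun s => ((ξ s - ξ 0) / s) ^ r - D ^ r) (𝓝[≠] 0) (𝓝 0) := by
    have := ((hasDerivAt_iff_tendsto_slope_zero.1 hξ).pow r).sub_const (D ^ r)
    rw [sub_self] at this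
    refine this.congr fun s => ?_
    simp [div_eq_inv_mul]
  have h7 : (fun s => (ξ s - ξ 0) ^ r - D ^ r * s ^ r) =o[𝓝[≠] 0] fun s : ℝ => s ^ r := by
    refine (Asymptotics.isLittleO_iff_tendsto' ?_).2 (h6.congr' ?_)
    · filter_upwards [self_mem_nhdsWithin] with s hs h0
      exact absurd h0 (pow_ne_zero r hs)
    · filter_upwards [self_mem_nhdsWithin] with s hs
      have h0 : s ≠ 0 := hs
      rw [eq_div_iff (pow_ne_zero r h0), div_pow, sub_mul, div_mul_cancel₀ _ (pow_ne_zero r h0)]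
  have h8 := h7.insert (by
    rcases Nat.eq_zero_or_pos r with rfl | hr
    · simp
    · simp [hr.ne'])
  have h9 : insert (0 : ℝ) {0}ᶜ = univ := by ext x; simp [em]
  rwa [h9, nhdsWithin_univ] at h8

theorem iteratedDeriv_of_comp_sub_isLittleO {h ξ : ℝ → ℝ} {D c : ℝ} {r : ℕ}
    (hh : ContDiff ℝ ∞ h) (hξ : HasDerivAt ξ D 0) (hD : D ≠ 0)
    (ho : (fun s => h (ξ s) - c * s ^ r) =o[𝓝 0] fun s : ℝ => s ^ r) :
    (∀ k < r, iteratedDeriv k h (ξ 0) = 0) ∧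
      iteratedDeriv r h (ξ 0) * D ^ r = r.factorial * c := by
  have hP : ContDiff ℝ ∞ fun y => c / D ^ r * (y - ξ 0) ^ r := by fun_prop
  -- Subtract the monomial with the predicted `r`th derivative, to reduce to the case of a vanishing
  -- leading coefficient.
  have key := iteratedDeriv_eq_zero_of_isLittleO (h := fun y => h y - c / D ^ r * (y - ξ 0) ^ r)
    (r := r) (hh.sub hP) hξ hD (by
      refine (ho.sub ((pow_sub_isLittleO hξ r).const_mul_left (c / D ^ r))).congr_left fun s => ?_
      have := pow_ne_zero r hD
      field_simp
      ring)
  have hder : ∀ k ≤ r, iteratedDeriv k h (ξ 0)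
      = c / D ^ r * iteratedDeriv k (fun y : ℝ => y ^ r) 0 := by
    intro k hk
    have h0 := key k hk
    have e1 : iteratedDeriv k (fun y => c / D ^ r * (y - ξ 0) ^ r) (ξ 0)
        = c / D ^ r * iteratedDeriv k (fun y : ℝ => y ^ r) 0 := by
      have := congrFun (iteratedDeriv_comp_sub_const k (fun y : ℝ => c / D ^ r * y ^ r) (ξ 0)) (ξ 0)
      simp only [sub_self] at this
      rw [this, iteratedDeriv_const_mul_field]
    have e2 := iteratedDeriv_sub (n := k) (x := ξ 0) (f := h)
      (g := fun y => c / D ^ r * (y - ξ 0) ^ r)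
      (hh.contDiffAt.of_le (by exact_mod_cast le_top)) (hP.contDiffAt.of_le (by exact_mod_cast le_top))
    have e3 : iteratedDeriv k (h - fun y => c / D ^ r * (y - ξ 0) ^ r) (ξ 0) = 0 := h0
    rw [e2, e1] at e3
    linarith
  constructor
  · intro k hk
    rw [hder k hk.le, iteratedDeriv_fun_pow_zero, if_neg (by omega), Nat.cast_zero, mul_zero]
  · rw [hder r le_rfl, iteratedDeriv_fun_pow_zero, if_pos rfl]
    have := pow_ne_zero r hD
    field_simp

/-! ### Partial derivatives and the equation with frozen `u`. -/

/-- The partial derivative in `t`. -/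
noncomputable def dt (f : Base → ℝ) (b : Base) : ℝ := deriv (fun s => f (s, b.2)) b.1

/-- The `k`th partial derivative in `x`. -/
noncomputable def dx (k : ℕ) (f : Base → ℝ) (b : Base) : ℝ := iteratedDeriv k (fun y => f (b.1, y)) b.2

/-- The part of the equation that is linear in `f` once the value `u` in front of `u_x` is
frozen. -/
noncomputable def linearPart {r : ℕ} (c : Coeffs r) (u : ℝ) (f : Base → ℝ) (b : Base) : ℝ :=
  dt f b + c.C * u * dx 1 f b - ∑ k : Fin (r + 1), c.A k * dx k f b

/-- Separates the only nonlinearity, the factor `u`, as a parameter of a linear operator; solution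
jets with the same value `u` can then be subtracted. -/
theorem jet_mem_equation_iff {r : ℕ} (hr : 1 ≤ r) (θ : Base → Coeffs r) (f : Base → ℝ) (b : Base) :
    jet r f b ∈ equation r θ ↔ linearPart (θ b) (f b) f b = (θ b).B := by
  have h0 : ∀ k ≤ r, (jet r f b).coord 0 k = dx k f b := by
    intro k hk
    simp [JetSpace.coord, jet, dx, hk]
  have h1 : (jet r f b).coord 1 0 = dt f b := by
    simp [JetSpace.coord, jet, dt, hr, iteratedDeriv_one]
  have h2 : dx 0 f b = f b := by simp [dx]
  have h3 : ∑ k : Fin (r + 1), (θ b).A k * (jet r f b).coord 0 k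
      = ∑ k : Fin (r + 1), (θ b).A k * dx k f b :=
    Finset.sum_congr rfl fun k _ => by rw [h0 k (Nat.lt_succ_iff.1 k.2)]
  change (jet r f b).coord 1 0 + (θ b).C * (jet r f b).coord 0 0 * (jet r f b).coord 0 1
    = ∑ k : Fin (r + 1), (θ b).A k * (jet r f b).coord 0 k + (θ b).B ↔ _
  rw [h3, h1, h0 0 (Nat.zero_le r), h0 1 hr, h2, linearPart]
  constructor <;> intro h <;> linarith

theorem contDiff_fst_slice {f : Base → ℝ} (hf : ContDiff ℝ ∞ f) (x : ℝ) :
    ContDiff ℝ ∞ fun s => f (s, x) := hf.comp (by fun_prop)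

theorem contDiff_snd_slice {f : Base → ℝ} (hf : ContDiff ℝ ∞ f) (t : ℝ) :
    ContDiff ℝ ∞ fun y => f (t, y) := hf.comp (by fun_prop)

theorem smooth_add {f g : Base → ℝ} (hf : ContDiff ℝ ∞ f) (hg : ContDiff ℝ ∞ g) :
    ContDiff ℝ ∞ (f + g) := hf.add hg

theorem smooth_smul {f : Base → ℝ} (c : ℝ) (hf : ContDiff ℝ ∞ f) : ContDiff ℝ ∞ (c • f) :=
  hf.const_smul c

theorem dt_add {f g : Base → ℝ} (hf : ContDiff ℝ ∞ f) (hg : ContDiff ℝ ∞ g) (b : Base) :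
    dt (f + g) b = dt f b + dt g b :=
  deriv_fun_add ((contDiff_fst_slice hf _).differentiable (by simp) _)
    ((contDiff_fst_slice hg _).differentiable (by simp) _)

theorem dt_smul {f : Base → ℝ} (c : ℝ) (b : Base) : dt (c • f) b = c * dt f b :=
  deriv_const_mul_field c

theorem dx_add (k : ℕ) {f g : Base → ℝ} (hf : ContDiff ℝ ∞ f) (hg : ContDiff ℝ ∞ g) (b : Base) :
    dx k (f + g) b = dx k f b + dx k g b :=
  iteratedDeriv_fun_add ((contDiff_snd_slice hf _).contDiffAt.of_le (by exact_mod_cast le_top))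
    ((contDiff_snd_slice hg _).contDiffAt.of_le (by exact_mod_cast le_top))

theorem dx_smul (k : ℕ) {f : Base → ℝ} (c : ℝ) (b : Base) : dx k (c • f) b = c * dx k f b :=
  iteratedDeriv_const_mul_field c _

theorem dt_sub {f g : Base → ℝ} (hf : ContDiff ℝ ∞ f) (hg : ContDiff ℝ ∞ g) (b : Base) :
    dt (f - g) b = dt f b - dt g b := by
  have e : f - g = f + (-1 : ℝ) • g := by ext; simp [sub_eq_add_neg]
  rw [e, dt_add hf (smooth_smul _ hg), dt_smul]
  ring

theorem dx_sub (k : ℕ) {f g : Base → ℝ} (hf : ContDiff ℝ ∞ f) (hg : ContDiff ℝ ∞ g) (b : Base) :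
    dx k (f - g) b = dx k f b - dx k g b := by
  have e : f - g = f + (-1 : ℝ) • g := by ext; simp [sub_eq_add_neg]
  rw [e, dx_add k hf (smooth_smul _ hg), dx_smul]
  ring

theorem smooth_sub {f g : Base → ℝ} (hf : ContDiff ℝ ∞ f) (hg : ContDiff ℝ ∞ g) :
    ContDiff ℝ ∞ (f - g) := hf.sub hg

theorem linearPart_add {r : ℕ} (c : Coeffs r) (u : ℝ) {f g : Base → ℝ} (hf : ContDiff ℝ ∞ f)
    (hg : ContDiff ℝ ∞ g) (b : Base) :
    linearPart c u (f + g) b = linearPart c u f b + linearPart c u g b := by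
  simp only [linearPart, dt_add hf hg, dx_add _ hf hg, mul_add, Finset.sum_add_distrib]
  ring

theorem linearPart_smul {r : ℕ} (c : Coeffs r) (u a : ℝ) (f : Base → ℝ) (b : Base) :
    linearPart c u (a • f) b = a * linearPart c u f b := by
  simp only [linearPart, dt_smul, dx_smul, mul_left_comm _ a, ← Finset.mul_sum]
  ring

theorem linearPart_sub {r : ℕ} (c : Coeffs r) (u : ℝ) {f g : Base → ℝ} (hf : ContDiff ℝ ∞ f)
    (hg : ContDiff ℝ ∞ g) (b : Base) :
    linearPart c u (f - g) b = linearPart c u f b - linearPart c u g b := by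
  simp only [linearPart, dt_sub hf hg, dx_sub _ hf hg, mul_sub, Finset.sum_sub_distrib]
  ring

theorem linearPart_eq_of_dx_eq_zero {r : ℕ} (hr : 2 ≤ r) (c : Coeffs r) (u : ℝ) {G : Base → ℝ}
    {b : Base} (h : ∀ k < r, dx k G b = 0) :
    linearPart c u G b = dt G b - c.A (Fin.last r) * dx r G b := by
  rw [linearPart, Fin.sum_univ_castSucc, Finset.sum_eq_zero, h 1 (by omega)]
  · simp
  · intro k _
    rw [Fin.val_castSucc, h k k.2, mul_zero]

theorem fderiv_apply_one_zero {f : Base → ℝ} (hf : ContDiff ℝ ∞ f) (b : Base) :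
    fderiv ℝ f b (1, 0) = dt f b := by
  have h1 := (hf.differentiable (by simp) b).hasFDerivAt
  have h2 : HasDerivAt (fun s : ℝ => ((s, b.2) : Base)) (1, 0) b.1 :=
    (hasDerivAt_id _).prodMk (hasDerivAt_const _ _)
  exact (h1.comp_hasDerivAt b.1 h2).deriv.symm

theorem fderiv_apply_zero_one {f : Base → ℝ} (hf : ContDiff ℝ ∞ f) (b : Base) :
    fderiv ℝ f b (0, 1) = dx 1 f b := by
  have h1 := (hf.differentiable (by simp) b).hasFDerivAt
  have h2 : HasDerivAt (fun s : ℝ => ((b.1, s) : Base)) (0, 1) b.2 :=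
    (hasDerivAt_const _ _).prodMk (hasDerivAt_id _)
  rw [dx, iteratedDeriv_one]
  exact (h1.comp_hasDerivAt b.2 h2).deriv.symm

theorem fderiv_apply_eq {f : Base → ℝ} (hf : ContDiff ℝ ∞ f) (b v : Base) :
    fderiv ℝ f b v = v.1 * dt f b + v.2 * dx 1 f b := by
  have : v = v.1 • ((1, 0) : Base) + v.2 • ((0, 1) : Base) := by ext <;> simp
  conv_lhs => rw [this]
  rw [map_add, map_smul, map_smul, fderiv_apply_one_zero hf, fderiv_apply_zero_one hf]
  simp

/-! ### Pairs of functions whose graphs correspond under the transformation. -/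

/-- The smooth functions `f` and `g` have graphs related by `φ` near the point of the graph of `f`
over `b`. -/
def IsPaired (φ : Total → Total) (f g : Base → ℝ) (b : Base) : Prop :=
  ContDiff ℝ ∞ f ∧ ContDiff ℝ ∞ g ∧ ∀ᶠ a in 𝓝 b, (φ (a, f a)).2 = g (φ (a, f a)).1

theorem MapsEquation.linearPart_iff {r : ℕ} (hr : 1 ≤ r) {W : Set Total} {φ : Total → Total}
    {θ θ' : Base → Coeffs r} (h : MapsEquation r W φ θ θ') {f g : Base → ℝ} {b : Base}
    (hp : IsPaired φ f g b) (hb : (b, f b) ∈ W) :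
    linearPart (θ b) (f b) f b = (θ b).B ↔
      linearPart (θ' (φ (b, f b)).1) (φ (b, f b)).2 g (φ (b, f b)).1
        = (θ' (φ (b, f b)).1).B := by
  rw [← jet_mem_equation_iff hr, hp.2.2.self_of_nhds, ← jet_mem_equation_iff hr]
  exact h _ _ ⟨f, g, b, hp.1, hp.2.1, hb, hp.2.2, rfl, rfl⟩

theorem hasFDerivAt_baseMap {W : Set Total} {φ : Total → Total} (hφ : IsPointTransformation W φ)
    {f : Base → ℝ} (hf : ContDiff ℝ ∞ f) {b : Base} (hb : (b, f b) ∈ W) :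
    HasFDerivAt (fun a => (φ (a, f a)).1)
      ((ContinuousLinearMap.fst ℝ Base ℝ).comp ((fderiv ℝ φ (b, f b)).comp
        ((ContinuousLinearMap.id ℝ Base).prod (fderiv ℝ f b)))) b := by
  have h1 := ((hφ.2.1.contDiffAt (hφ.1.mem_nhds hb)).differentiableAt (by simp)).hasFDerivAt
  have h2 := (hasFDerivAt_id (𝕜 := ℝ) b).prodMk (hf.differentiable (by simp) b).hasFDerivAt
  exact hasFDerivAt_fst.comp b (h1.comp b h2)

theorem exists_baseMap_localInverse {W : Set Total} {φ : Total → Total}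
    (hφ : IsPointTransformation W φ) {f : Base → ℝ} (hf : ContDiff ℝ ∞ f) {b : Base}
    (hb : (b, f b) ∈ W)
    (hinj : ∀ v : Base, (fderiv ℝ φ (b, f b) (v, fderiv ℝ f b v)).1 = 0 → v = 0) :
    ∃ (N : Set Base) (χ : Base → Base), IsOpen N ∧ (φ (b, f b)).1 ∈ N ∧ ContDiffOn ℝ ∞ χ N ∧
      (∀ q ∈ N, (χ q, f (χ q)) ∈ W ∧ (φ (χ q, f (χ q))).1 = q) ∧
      ∀ᶠ a in 𝓝 b, χ (φ (a, f a)).1 = a := by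
  have hi : ContDiff ℝ ∞ fun a => ((a, f a) : Total) := contDiff_id.prodMk hf
  have hc : ContDiffOn ℝ ∞ (fun a => φ (a, f a)) ((fun a => ((a, f a) : Total)) ⁻¹' W) :=
    hφ.2.1.comp hi.contDiffOn fun a ha => ha
  exact exists_contDiffOn_localInverse (b := b) (hφ.1.preimage hi.continuous) hb hc.fst
    (by rw [(hasFDerivAt_baseMap hφ hf hb).fderiv]
        exact isInvertible_of_injective fun v hv => hinj v hv)

/-- The hypothesis says that the image of the graph is transversal to the fibres of `u`, so it is
locally a graph again; its function is cut off to a global one. -/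
theorem exists_isPaired {W : Set Total} {φ : Total → Total} (hφ : IsPointTransformation W φ)
    {f : Base → ℝ} (hf : ContDiff ℝ ∞ f) {b : Base} (hb : (b, f b) ∈ W)
    (hinj : ∀ v : Base, (fderiv ℝ φ (b, f b) (v, fderiv ℝ f b v)).1 = 0 → v = 0) :
    ∃ g, IsPaired φ f g b := by
  obtain ⟨N, χ, hN, hbN, hχ, hχO, hχ'⟩ := exists_baseMap_localInverse hφ hf hb hinj
  have hi : ContDiff ℝ ∞ fun a => ((a, f a) : Total) := contDiff_id.prodMk hf
  have hc : ContDiffOn ℝ ∞ (fun q => φ (χ q, f (χ q))) N :=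
    hφ.2.1.comp (hi.comp_contDiffOn hχ) fun q hq => (hχO q hq).1
  obtain ⟨g, hg, hgN⟩ := exists_contDiff_eventuallyEq hN hbN hc.snd
  refine ⟨g, hf, hg, ?_⟩
  filter_upwards [hχ', (hasFDerivAt_baseMap hφ hf hb).continuousAt.eventually hgN] with a h1 h2
  rw [h2, h1]

theorem IsPaired.fderiv_eq {W : Set Total} {φ : Total → Total} (hφ : IsPointTransformation W φ)
    {f g : Base → ℝ} {b : Base} (hp : IsPaired φ f g b) (hb : (b, f b) ∈ W) (v : Base) :
    (fderiv ℝ φ (b, f b) (v, fderiv ℝ f b v)).2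
      = fderiv ℝ g (φ (b, f b)).1 (fderiv ℝ φ (b, f b) (v, fderiv ℝ f b v)).1 := by
  obtain ⟨hf, hg, he⟩ := hp
  have h1 := ((hφ.2.1.contDiffAt (hφ.1.mem_nhds hb)).differentiableAt (by simp)).hasFDerivAt
  have h2 := (hasFDerivAt_id (𝕜 := ℝ) b).prodMk (hf.differentiable (by simp) b).hasFDerivAt
  have h3 := h1.comp b h2
  have h4 := hasFDerivAt_snd.comp b h3
  have h5 := (hg.differentiable (by simp) (φ (b, f b)).1).hasFDerivAt.comp b
    (hasFDerivAt_fst.comp b h3)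
  exact congrArg (fun L => L v) (h4.unique (h5.congr_of_eventuallyEq he))

/-- Differences of source functions and of image functions are proportional to leading order. The
function `H = U - g₂ ∘ (T, X)` vanishes on the graph of `f₂` and equals `g₁ - g₂` at the image point
on the graph of `f₁`; strict differentiability of `H` compares the two graphs vertically. -/
theorem IsPaired.exists_sub_isLittleO {W : Set Total} {φ : Total → Total}
    (hφ : IsPointTransformation W φ) {f₁ f₂ g₁ g₂ : Base → ℝ} {b : Base}
    (hp₁ : IsPaired φ f₁ g₁ b) (hp₂ : IsPaired φ f₂ g₂ b) (hf : f₁ b = f₂ b)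
    (hb : (b, f₁ b) ∈ W) :
    ∃ κ : ℝ, κ ≠ 0 ∧ (fun a => (g₁ - g₂) (φ (a, f₁ a)).1 - κ * (f₁ a - f₂ a))
      =o[𝓝 b] fun a => f₁ a - f₂ a := by
  have hs := hφ.2.1.contDiffAt (hφ.1.mem_nhds hb)
  have hφd := (hs.differentiableAt (by simp)).hasFDerivAt
  let H : Total → ℝ := fun q => (φ q).2 - g₂ (φ q).1
  have hHs : ContDiffAt ℝ ∞ H (b, f₁ b) := hs.snd.sub (hp₂.2.1.contDiffAt.comp _ hs.fst)
  have hH := hHs.hasStrictFDerivAt (by simp)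
  have hH' : ∀ w, fderiv ℝ H (b, f₁ b) w = (fderiv ℝ φ (b, f₁ b) w).2
      - fderiv ℝ g₂ (φ (b, f₁ b)).1 (fderiv ℝ φ (b, f₁ b) w).1 := by
    have := (hasFDerivAt_snd.comp (b, f₁ b) hφd).sub
      ((hp₂.2.1.differentiable (by simp) (φ (b, f₁ b)).1).hasFDerivAt.comp (b, f₁ b)
        (hasFDerivAt_fst.comp (b, f₁ b) hφd))
    intro w
    exact congrArg (fun L => L w) (hH.hasFDerivAt.unique this)
  refine ⟨fderiv ℝ H (b, f₁ b) (0, 1), fun h0 => ?_, ?_⟩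
  -- If `H_u` vanished, the differential of `H` would vanish altogether, since it does so along the
  -- graph of `f₂`; but it takes the value 1 on the preimage of the vertical vector.
  · obtain ⟨⟨v, z⟩, hw⟩ := (hφ.2.2.2 _ hb).surjective ((0, 1) : Total)
    have h1 := hH' (v, z)
    rw [hw] at h1
    have h2 := hp₂.fderiv_eq hφ (hf ▸ hb) v
    rw [← hf] at h2
    have h3 := hH' (v, fderiv ℝ f₂ b v)
    rw [h2, sub_self] at h3
    have h4 : ((v, z) : Total) = (v, fderiv ℝ f₂ b v) + (z - fderiv ℝ f₂ b v) • (0, 1) := by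
      ext <;> simp
    rw [h4, map_add, map_smul, h0, h3] at h1
    simp at h1
  · have hc : Tendsto (fun a => (((a, f₁ a), (a, f₂ a)) : Total × Total)) (𝓝 b)
        (𝓝 ((b, f₁ b), (b, f₁ b))) := by
      have h1 : Continuous fun a => (((a, f₁ a), (a, f₂ a)) : Total × Total) :=
        (continuous_id.prodMk hp₁.1.continuous).prodMk (continuous_id.prodMk hp₂.1.continuous)
      have h2 := h1.tendsto b
      rwa [← hf] at h2
    have h1 := hH.isLittleO.comp_tendsto hc
    have h2 : (fun a => (((a, f₁ a) : Total) - (a, f₂ a))) =O[𝓝 b] fun a => f₁ a - f₂ a := by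
      refine .of_bound 1 (.of_forall fun a => ?_)
      simp [Prod.norm_def]
    refine (h1.trans_isBigO h2).congr' ?_ .rfl
    filter_upwards [hp₁.2.2, hp₂.2.2] with a h3 h4
    have h5 : ((a, f₁ a) : Total) - (a, f₂ a) = (f₁ a - f₂ a) • (0, 1) := by ext <;> simp
    simp only [Function.comp, h5, map_smul, H, h4, sub_self, sub_zero, h3, Pi.sub_apply,
      smul_eq_mul]
    ring

/-! ### Polynomial test functions. -/

/-- The monomial `(t - t₀)ᵏ` centred at `b = (t₀, x₀)`. -/
def monT (k : ℕ) (b : Base) : Base → ℝ := fun a => (a.1 - b.1) ^ k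

/-- The monomial `(x - x₀)ᵏ` centred at `b = (t₀, x₀)`. -/
def monX (k : ℕ) (b : Base) : Base → ℝ := fun a => (a.2 - b.2) ^ k

theorem contDiff_monT (k : ℕ) (b : Base) : ContDiff ℝ ∞ (monT k b) := by
  unfold monT; fun_prop

theorem contDiff_monX (k : ℕ) (b : Base) : ContDiff ℝ ∞ (monX k b) := by
  unfold monX; fun_prop

theorem dt_monT (k : ℕ) (b : Base) : dt (monT k b) b = if k = 1 then 1 else 0 := by
  have := iteratedDeriv_fun_pow_zero (𝕜 := ℝ) (n := 1) (m := k)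
  have h2 := congrFun (iteratedDeriv_comp_sub_const 1 (fun y : ℝ => y ^ k) b.1) b.1
  rw [iteratedDeriv_one] at h2
  simp only [sub_self] at h2
  rw [dt]
  simp only [monT]
  rw [h2, this]
  by_cases hk : k = 1
  · subst hk; simp
  · rw [if_neg (Ne.symm hk), if_neg hk, Nat.cast_zero]

theorem dx_monT (j : ℕ) {k : ℕ} (hk : k ≠ 0) (b : Base) : dx j (monT k b) b = 0 := by
  simp [dx, monT, hk]

theorem dt_monX (k : ℕ) (b : Base) : dt (monX k b) b = 0 := by simp [dt, monX]

theorem dx_monX (j k : ℕ) (b : Base) :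
    dx j (monX k b) b = if j = k then (k.factorial : ℝ) else 0 := by
  have := iteratedDeriv_fun_pow_zero (𝕜 := ℝ) (n := j) (m := k)
  have h2 := congrFun (iteratedDeriv_comp_sub_const j (fun y : ℝ => y ^ k) b.2) b.2
  simp only [sub_self] at h2
  rw [dx]
  simp only [monX]
  rw [h2, this]
  split_ifs <;> simp

theorem linearPart_monT {r k : ℕ} (hk : k ≠ 0) (c : Coeffs r) (u : ℝ) (b : Base) :
    linearPart c u (monT k b) b = if k = 1 then 1 else 0 := by
  simp [linearPart, dt_monT, dx_monT _ hk]

theorem linearPart_monX_self {r : ℕ} (hr : 2 ≤ r) (c : Coeffs r) (u : ℝ) (b : Base) :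
    linearPart c u (monX r b) b = -(c.A (Fin.last r) * r.factorial) := by
  rw [linearPart_eq_of_dx_eq_zero hr, dt_monX, dx_monX, if_pos rfl, zero_sub]
  intro k hk
  rw [dx_monX, if_neg hk.ne]

/-- The test function `u + τ (t - t₀) + α (x - x₀) + β (x - x₀)ⁿ`. -/
def testFun (b : Base) (u τ α β : ℝ) (n : ℕ) : Base → ℝ :=
  u • monX 0 b + τ • monT 1 b + α • monX 1 b + β • monX n b

section testFun
variable (b : Base) (u τ α β : ℝ) (n : ℕ)

theorem contDiff_testFun : ContDiff ℝ ∞ (testFun b u τ α β n) :=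
  ((((contDiff_monX 0 b).const_smul u).add ((contDiff_monT 1 b).const_smul τ)).add
    ((contDiff_monX 1 b).const_smul α)).add ((contDiff_monX n b).const_smul β)

theorem testFun_apply (a : Base) : testFun b u τ α β n a
    = u + τ * (a.1 - b.1) + α * (a.2 - b.2) + β * (a.2 - b.2) ^ n := by
  simp [testFun, monX, monT]

theorem testFun_self (hn : n ≠ 0) : testFun b u τ α β n b = u := by
  simp [testFun_apply, hn]

theorem dt_testFun : dt (testFun b u τ α β n) b = τ := by
  have h0 : ContDiff ℝ ∞ (u • monX 0 b) := (contDiff_monX 0 b).const_smul u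
  have h1 : ContDiff ℝ ∞ (τ • monT 1 b) := (contDiff_monT 1 b).const_smul τ
  have h2 : ContDiff ℝ ∞ (α • monX 1 b) := (contDiff_monX 1 b).const_smul α
  have h3 : ContDiff ℝ ∞ (β • monX n b) := (contDiff_monX n b).const_smul β
  rw [testFun, dt_add (smooth_add (smooth_add h0 h1) h2) h3, dt_add (smooth_add h0 h1) h2, dt_add h0 h1]
  simp [dt_smul, dt_monX, dt_monT]

theorem dx_testFun (k : ℕ) : dx k (testFun b u τ α β n) b = u * dx k (monX 0 b) b
    + α * dx k (monX 1 b) b + β * dx k (monX n b) b := by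
  have h0 : ContDiff ℝ ∞ (u • monX 0 b) := (contDiff_monX 0 b).const_smul u
  have h1 : ContDiff ℝ ∞ (τ • monT 1 b) := (contDiff_monT 1 b).const_smul τ
  have h2 : ContDiff ℝ ∞ (α • monX 1 b) := (contDiff_monX 1 b).const_smul α
  have h3 : ContDiff ℝ ∞ (β • monX n b) := (contDiff_monX n b).const_smul β
  rw [testFun, dx_add k (smooth_add (smooth_add h0 h1) h2) h3, dx_add k (smooth_add h0 h1) h2, dx_add k h0 h1]
  simp [dx_smul, dx_monT]

theorem fderiv_testFun (v : Base) : fderiv ℝ (testFun b u τ α β n) b v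
    = τ * v.1 + (α + if n = 1 then β else 0) * v.2 := by
  rw [fderiv_apply_eq (contDiff_testFun b u τ α β n), dt_testFun, dx_testFun]
  simp only [dx_monX]
  by_cases hn : n = 1
  · subst hn; simp; ring
  · simp [hn, Ne.symm hn]; ring

theorem linearPart_testFun {r : ℕ} (c : Coeffs r) (v : ℝ) :
    linearPart c v (testFun b u τ α β n) b = τ + u * linearPart c v (monX 0 b) b
      + α * linearPart c v (monX 1 b) b + β * linearPart c v (monX n b) b := by
  have h0 : ContDiff ℝ ∞ (u • monX 0 b) := (contDiff_monX 0 b).const_smul u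
  have h1 : ContDiff ℝ ∞ (τ • monT 1 b) := (contDiff_monT 1 b).const_smul τ
  have h2 : ContDiff ℝ ∞ (α • monX 1 b) := (contDiff_monX 1 b).const_smul α
  have h3 : ContDiff ℝ ∞ (β • monX n b) := (contDiff_monX n b).const_smul β
  rw [testFun, linearPart_add _ _ (smooth_add (smooth_add h0 h1) h2) h3, linearPart_add _ _ (smooth_add h0 h1) h2,
    linearPart_add _ _ h0 h1]
  simp only [linearPart_smul, linearPart_monT one_ne_zero, if_true]
  ring

end testFun

/-! ### Transport of vanishing orders to the target plane. -/

/-- Pull the line back by the local inverse of the base map: the preimage curve has velocity `v`, so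
`(t - t₀)ʳ` along it is `v.1 ^ r * s ^ r` to leading order. -/
theorem sub_isLittleO_along_line {W : Set Total} {φ : Total → Total}
    (hφ : IsPointTransformation W φ) {f : Base → ℝ} (hf : ContDiff ℝ ∞ f) {b : Base}
    (hb : (b, f b) ∈ W)
    (hinj : ∀ v : Base, (fderiv ℝ φ (b, f b) (v, fderiv ℝ f b v)).1 = 0 → v = 0)
    {G : Base → ℝ} {κ : ℝ} {r : ℕ}
    (hG : (fun a => G (φ (a, f a)).1 - κ * monT r b a) =o[𝓝 b] monT r b) (e : Base) :
    ∃ v : Base, (fderiv ℝ φ (b, f b) (v, fderiv ℝ f b v)).1 = e ∧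
      (fun s : ℝ => G ((φ (b, f b)).1 + s • e) - κ * v.1 ^ r * s ^ r)
        =o[𝓝 0] fun s : ℝ => s ^ r := by
  obtain ⟨N, χ, hN, hbN, hχ, hχO, hχ'⟩ := exists_baseMap_localInverse hφ hf hb hinj
  set q := (φ (b, f b)).1 with hq
  have hχq : χ q = b := hχ'.self_of_nhds
  have hχd := ((hχ.contDiffAt (hN.mem_nhds hbN)).differentiableAt (by simp)).hasFDerivAt
  have hψd := hasFDerivAt_baseMap hφ hf hb
  have hl : HasDerivAt (fun s : ℝ => q + s • e) e 0 := by
    simpa using ((hasDerivAt_id (0 : ℝ)).smul_const e).const_add q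
  have ha : HasDerivAt (fun s : ℝ => χ (q + s • e)) (fderiv ℝ χ q e) 0 := by
    refine HasFDerivAt.comp_hasDerivAt (0 : ℝ) (f := fun s : ℝ => q + s • e) ?_ hl
    simpa using hχd
  have ha0 : χ (q + (0 : ℝ) • e) = b := by simpa using hχq
  have hlN : ∀ᶠ s : ℝ in 𝓝 0, q + s • e ∈ N :=
    hl.continuousAt.eventually (hN.mem_nhds (by simpa using hbN))
  refine ⟨fderiv ℝ χ q e, ?_, ?_⟩
  · have h1 : HasFDerivAt (fun x => (φ (χ x, f (χ x))).1) _ q :=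
      HasFDerivAt.comp q (g := fun a => (φ (a, f a)).1) (f := χ) (hχq.symm ▸ hψd) hχd
    have h2 : HasFDerivAt (fun x => (φ (χ x, f (χ x))).1) (ContinuousLinearMap.id ℝ Base) q :=
      (hasFDerivAt_id q).congr_of_eventuallyEq
        (by filter_upwards [hN.mem_nhds hbN] with x hx using (hχO x hx).2)
    have h3 := congrArg (fun L => L e) (h1.unique h2)
    rw [hχq] at h3
    exact h3
  · have h1 := pow_sub_isLittleO (hasFDerivAt_fst.comp_hasDerivAt (0 : ℝ) ha) r
    simp only [ha0, ContinuousLinearMap.coe_fst', Function.comp] at h1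
    have hc : Tendsto (fun s : ℝ => χ (q + s • e)) (𝓝 0) (𝓝 b) := by
      have := ha.continuousAt.tendsto
      rwa [ha0] at this
    have h2 := hG.comp_tendsto hc
    have h3 : (monT r b ∘ fun s : ℝ => χ (q + s • e)) =O[𝓝 0] fun s : ℝ => s ^ r := by
      have h4 : (fun s : ℝ => (fderiv ℝ χ q e).1 ^ r * s ^ r) =O[𝓝 0] fun s : ℝ => s ^ r :=
        Asymptotics.isBigO_const_mul_self _ _ _
      refine (h1.isBigO.add h4).congr_left fun s => ?_
      simp [monT]
    refine ((h2.trans_isBigO h3).add (h1.const_mul_left κ)).congr' ?_ .rfl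
    filter_upwards [hlN] with s hs
    simp only [Function.comp, (hχO _ hs).2, monT]
    ring

theorem dx_eq_of_isLittleO {G : Base → ℝ} (hG : ContDiff ℝ ∞ G) {q : Base} {ξ : ℝ → ℝ}
    {D c : ℝ} {r : ℕ} (hξ : HasDerivAt ξ D 0) (hξ0 : ξ 0 = q.2) (hD : D ≠ 0)
    (ho : (fun s => G (q.1, ξ s) - c * s ^ r) =o[𝓝 0] fun s : ℝ => s ^ r) :
    (∀ k < r, dx k G q = 0) ∧ dx r G q * D ^ r = r.factorial * c := by
  have := iteratedDeriv_of_comp_sub_isLittleO (contDiff_snd_slice hG q.1) hξ hD ho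
  rwa [hξ0] at this

theorem A_last_ne_zero {r : ℕ} {c : Coeffs r} (hc : c ∈ regular r) : c.A (Fin.last r) ≠ 0 :=
  right_ne_zero_of_mul hc

theorem C_ne_zero {r : ℕ} {c : Coeffs r} (hc : c ∈ regular r) : c.C ≠ 0 :=
  left_ne_zero_of_mul hc

/-! ### The new time depends on the old time only. -/

section admissible
variable {r : ℕ} {W : Set Total} {φ : Total → Total} {θ θ' : Base → Coeffs r}

theorem IsAdmissible.regular_left (h : IsAdmissible r W θ θ' φ) {p : Total} (hp : p ∈ W) :
    θ p.1 ∈ regular r := h.2.1.2 _ (mem_image_of_mem _ hp)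

theorem IsAdmissible.regular_right (h : IsAdmissible r W θ θ' φ) {p : Total} (hp : p ∈ W) :
    θ' (φ p).1 ∈ regular r := h.2.2.1.2 _ (mem_image_of_mem _ (mem_image_of_mem _ hp))

/-- Two source functions differing by `(t - t₀)ʳ` satisfy the equation at `b` simultaneously, as `r
≥ 2`. Their images differ to order `r`, so the target equation leaves only `∂ₓʳ G = 0`. That
derivative is a nonzero multiple of the `r`th power of the time component of the preimage of the new
`x`-direction; hence this preimage is a multiple of `(0, 1)`. -/
theorem IsAdmissible.fst_fst_eq_zero_of_transversal (hr : 2 ≤ r) (h : IsAdmissible r W θ θ' φ)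
    {p : Total} (hp : p ∈ W) {τ α : ℝ}
    (hnd : ∀ v : Base, (fderiv ℝ φ p (v, τ * v.1 + α * v.2)).1 = 0 → v = 0) :
    (fderiv ℝ φ p ((0, 1), α)).1.1 = 0 := by
  obtain ⟨b, u⟩ := p
  have hA : (θ b).A (Fin.last r) ≠ 0 := A_last_ne_zero (h.regular_left hp)
  have hA' : (θ' (φ (b, u)).1).A (Fin.last r) ≠ 0 := A_last_ne_zero (h.regular_right hp)
  have hφ := h.1
  have hfac : (r.factorial : ℝ) ≠ 0 := by positivity
  -- The slopes `τ` and `α` are prescribed, so the equation at `b` is solved for the coefficient of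
  -- `(x - x₀)ʳ`, which is possible because `Aʳ ≠ 0`.
  obtain ⟨γ, hγ⟩ : ∃ γ, linearPart (θ b) u (testFun b u τ α γ r) b = (θ b).B := by
    refine ⟨(τ + u * linearPart (θ b) u (monX 0 b) b + α * linearPart (θ b) u (monX 1 b) b
      - (θ b).B) / ((θ b).A (Fin.last r) * r.factorial), ?_⟩
    rw [linearPart_testFun, linearPart_monX_self hr]
    field_simp
    ring
  set f₂ := testFun b u τ α γ r with hf₂
  have hf₂s : ContDiff ℝ ∞ f₂ := contDiff_testFun ..
  have hms := contDiff_monT r b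
  have hf₁s : ContDiff ℝ ∞ (f₂ + monT r b) := hf₂s.add hms
  have hf₂b : f₂ b = u := testFun_self _ _ _ _ _ _ (by omega)
  have hf₁b : (f₂ + monT r b) b = u := by simp [hf₂b, monT, show r ≠ 0 by omega]
  have hd₂ : ∀ v, fderiv ℝ f₂ b v = τ * v.1 + α * v.2 := by
    intro v
    rw [hf₂, fderiv_testFun, if_neg (by omega), add_zero]
  have hd₁ : ∀ v, fderiv ℝ (f₂ + monT r b) b v = τ * v.1 + α * v.2 := by
    intro v
    rw [fderiv_add (hf₂s.differentiable (by simp) b) (hms.differentiable (by simp) b),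
      add_apply, hd₂, fderiv_apply_eq hms, dt_monT, dx_monT _ (by omega),
      if_neg (by omega)]
    simp
  have hb₁ : (b, (f₂ + monT r b) b) ∈ W := by rwa [hf₁b]
  have hb₂ : (b, f₂ b) ∈ W := by rwa [hf₂b]
  have hi₁ : ∀ v : Base, (fderiv ℝ φ (b, (f₂ + monT r b) b)
      (v, fderiv ℝ (f₂ + monT r b) b v)).1 = 0 → v = 0 := by
    intro v; rw [hd₁, hf₁b]; exact hnd v
  obtain ⟨g₁, hp₁⟩ := exists_isPaired hφ hf₁s hb₁ hi₁
  obtain ⟨g₂, hp₂⟩ := exists_isPaired hφ hf₂s hb₂ (by intro v; rw [hd₂, hf₂b]; exact hnd v)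
  have hs₂ := (h.2.2.2.linearPart_iff (by omega) hp₂ hb₂).1 (by rwa [hf₂b])
  have hs₁ := (h.2.2.2.linearPart_iff (by omega) hp₁ hb₁).1 (by
    rw [hf₁b, linearPart_add _ _ hf₂s hms, hγ, linearPart_monT (by omega), if_neg (by omega),
      add_zero])
  obtain ⟨κ, hκ, ho⟩ := hp₁.exists_sub_isLittleO hφ hp₂ (by rw [hf₁b, hf₂b]) hb₁
  have ho' : (fun a => (g₁ - g₂) (φ (a, (f₂ + monT r b) a)).1 - κ * monT r b a)
      =o[𝓝 b] monT r b := by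
    simpa using ho
  have hGs : ContDiff ℝ ∞ (g₁ - g₂) := hp₁.2.1.sub hp₂.2.1
  obtain ⟨v, hv, hov⟩ := sub_isLittleO_along_line hφ hf₁s hb₁ hi₁ ho' (0, 1)
  obtain ⟨w, -, how⟩ := sub_isLittleO_along_line hφ hf₁s hb₁ hi₁ ho' (1, 0)
  rw [hf₁b] at hs₁ hv hov how
  rw [hf₂b] at hs₂
  set q := (φ (b, u)).1
  have hx := dx_eq_of_isLittleO (ξ := fun s => q.2 + s) (q := q) (c := κ * v.1 ^ r) hGs
    ((hasDerivAt_id (0 : ℝ)).const_add q.2) (by simp) one_ne_zero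
    (hov.congr_left fun s => by simp [Prod.add_def])
  have ht : dt (g₁ - g₂) q = 0 := by
    have := (iteratedDeriv_of_comp_sub_isLittleO (ξ := fun s => q.1 + s) (c := κ * w.1 ^ r)
      (contDiff_fst_slice hGs q.2) ((hasDerivAt_id (0 : ℝ)).const_add q.1) one_ne_zero
      (how.congr_left fun s => by simp [Prod.add_def])).1 1 (by omega)
    simpa [iteratedDeriv_one, dt] using this
  have hL : linearPart (θ' q) (φ (b, u)).2 (g₁ - g₂) q = 0 := by
    rw [linearPart_sub _ _ hp₁.2.1 hp₂.2.1, hs₁, hs₂, sub_self]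
  rw [linearPart_eq_of_dx_eq_zero hr _ _ hx.1, ht, zero_sub, neg_eq_zero, mul_eq_zero,
    or_iff_right hA'] at hL
  have hx2 := hx.2
  rw [hL, zero_mul] at hx2
  have hv1 : v.1 = 0 := by
    by_contra hne
    have := mul_ne_zero hfac (mul_ne_zero hκ (pow_ne_zero r hne))
    exact this hx2.symm
  rw [hd₁, hv1] at hv
  have hv' : ((v, τ * 0 + α * v.2) : Total) = v.2 • ((0, 1), α) := by
    ext <;> simp [hv1, mul_comm]
  rw [hv', map_smul] at hv
  have e1 : v.2 * (fderiv ℝ φ (b, u) ((0, 1), α)).1.1 = 0 := by simpa using congrArg Prod.fst hv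
  have e2 : v.2 * (fderiv ℝ φ (b, u) ((0, 1), α)).1.2 = 1 := by simpa using congrArg Prod.snd hv
  exact (mul_eq_zero.1 e1).resolve_left (left_ne_zero_of_mul_eq_one e2)

theorem total_decomp (v : Base) (z : ℝ) : ((v, z) : Total)
    = v.1 • ((1, 0), 0) + v.2 • ((0, 1), 0) + z • ((0, 0), 1) := by
  ext <;> simp

/-- The determinant in `key` is affine in `τ` and `α`, with the three minors as coefficients. If `Tx
+ α * Tu` were not identically zero in `α`, it would be nonzero at two values `α` differing by 1;
there the determinant vanishes for all `τ`, so all minors vanish. -/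
theorem eq_zero_of_minors {Tt Tx Tu Xt Xx Xu : ℝ}
    (hmin : ¬(Tt * Xx - Tx * Xt = 0 ∧ Tu * Xx - Tx * Xu = 0 ∧ Tt * Xu - Tu * Xt = 0))
    (key : ∀ τ α : ℝ,
      (Tt + τ * Tu) * (Xx + α * Xu) - (Tx + α * Tu) * (Xt + τ * Xu) ≠ 0 → Tx + α * Tu = 0) :
    Tx = 0 ∧ Tu = 0 := by
  have aff : ∀ α, Tx + α * Tu ≠ 0 → Tu * Xx - Tx * Xu = 0 ∧
      (Tt * Xx - Tx * Xt) + α * (Tt * Xu - Tu * Xt) = 0 := by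
    intro α hα
    have h0 := not_ne_iff.1 (mt (key 0 α) hα)
    have h1 := not_ne_iff.1 (mt (key 1 α) hα)
    constructor
    · linear_combination h1 - h0
    · linear_combination h0
  by_cases hu : Tu = 0
  · refine ⟨?_, hu⟩
    by_contra hx
    have h0 := aff 0 (by simpa [hu] using hx)
    have h1 := aff 1 (by simpa [hu] using hx)
    exact hmin ⟨by linear_combination h0.2, h0.1, by linear_combination h1.2 - h0.2⟩
  · exfalso
    have h0 := aff ((Tu - Tx) / Tu) (by rw [div_mul_cancel₀ _ hu]; simpa using hu)
    have h1 := aff ((Tu - Tx) / Tu + 1) (by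
      rw [add_mul, div_mul_cancel₀ _ hu]; ring_nf; simpa using hu)
    exact hmin ⟨by linear_combination h0.2 - (Tu - Tx) / Tu * (h1.2 - h0.2), h0.1,
      by linear_combination h1.2 - h0.2⟩

theorem IsAdmissible.fst_fst_eq_zero (hr : 2 ≤ r) (h : IsAdmissible r W θ θ' φ)
    {p : Total} (hp : p ∈ W) :
    (fderiv ℝ φ p ((0, 1), 0)).1.1 = 0 ∧ (fderiv ℝ φ p ((0, 0), 1)).1.1 = 0 := by
  set M := fderiv ℝ φ p with hM
  have hMap : ∀ (v : Base) (z : ℝ),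
      (M (v, z)).1.1 = v.1 * (M ((1, 0), 0)).1.1 + v.2 * (M ((0, 1), 0)).1.1
        + z * (M ((0, 0), 1)).1.1 ∧
      (M (v, z)).1.2 = v.1 * (M ((1, 0), 0)).1.2 + v.2 * (M ((0, 1), 0)).1.2
        + z * (M ((0, 0), 1)).1.2 := by
    intro v z
    rw [total_decomp, map_add, map_add, map_smul, map_smul, map_smul]
    constructor <;> simp
  refine eq_zero_of_minors (Tt := (M ((1, 0), 0)).1.1) (Xt := (M ((1, 0), 0)).1.2)
    (Xx := (M ((0, 1), 0)).1.2) (Xu := (M ((0, 0), 1)).1.2) ?_ fun τ α hne => ?_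
  -- With all 2×2 minors zero, the `(t, x)`-part of the differential would have rank below 2,
  -- contradicting surjectivity.
  · rintro ⟨h1, h2, h3⟩
    obtain ⟨⟨v, z⟩, hv⟩ := (h.1.2.2.2 p hp).surjective ((1, 0), 0)
    obtain ⟨⟨w, y⟩, hw⟩ := (h.1.2.2.2 p hp).surjective ((0, 1), 0)
    have ev := hMap v z
    have ew := hMap w y
    rw [show M (v, z) = _ from hv] at ev
    rw [show M (w, y) = _ from hw] at ew
    obtain ⟨v1, v2⟩ := ev
    obtain ⟨w1, w2⟩ := ew
    dsimp only at v1 v2 w1 w2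
    generalize (M ((1, 0), 0)).1.1 = Tt at *
    generalize (M ((1, 0), 0)).1.2 = Xt at *
    generalize (M ((0, 1), 0)).1.1 = Tx at *
    generalize (M ((0, 1), 0)).1.2 = Xx at *
    generalize (M ((0, 0), 1)).1.1 = Tu at *
    generalize (M ((0, 0), 1)).1.2 = Xu at *
    have : (1 : ℝ) = 0 := by
      calc (1 : ℝ) = 1 * 1 - 0 * 0 := by ring
        _ = (v.1 * Tt + v.2 * Tx + z * Tu) * (w.1 * Xt + w.2 * Xx + y * Xu)
          - (w.1 * Tt + w.2 * Tx + y * Tu) * (v.1 * Xt + v.2 * Xx + z * Xu) := by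
            rw [← v1, ← v2, ← w1, ← w2]
        _ = 0 := by
            linear_combination (v.1 * w.2 - v.2 * w.1) * h1 + (z * w.2 - v.2 * y) * h2
              + (v.1 * y - z * w.1) * h3
    exact one_ne_zero this
  · have hv := h.fst_fst_eq_zero_of_transversal hr hp (τ := τ) (α := α) fun v hv => by
      obtain ⟨e1, e2⟩ := hMap v (τ * v.1 + α * v.2)
      rw [← hM] at hv
      rw [hv] at e1 e2
      dsimp only [Prod.fst_zero, Prod.snd_zero] at e1 e2
      generalize (M ((1, 0), 0)).1.1 = Tt at *
      generalize (M ((1, 0), 0)).1.2 = Xt at *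
      generalize (M ((0, 1), 0)).1.1 = Tx at *
      generalize (M ((0, 1), 0)).1.2 = Xx at *
      generalize (M ((0, 0), 1)).1.1 = Tu at *
      generalize (M ((0, 0), 1)).1.2 = Xu at *
      have d1 : v.1 * ((Tt + τ * Tu) * (Xx + α * Xu) - (Tx + α * Tu) * (Xt + τ * Xu)) = 0 := by
        linear_combination (Tx + α * Tu) * e2 - (Xx + α * Xu) * e1
      have d2 : v.2 * ((Tt + τ * Tu) * (Xx + α * Xu) - (Tx + α * Tu) * (Xt + τ * Xu)) = 0 := by
        linear_combination (Xt + τ * Xu) * e1 - (Tt + τ * Tu) * e2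
      exact Prod.ext ((mul_eq_zero.1 d1).resolve_right hne) ((mul_eq_zero.1 d2).resolve_right hne)
    have e1 := (hMap (0, 1) α).1
    rw [← hM] at hv
    rw [hv] at e1
    simpa using e1.symm

end admissible

/-! ### Factorization through projections, and mixed differences. -/

theorem eq_of_fderiv_sub_eq_zero {E : Type*} [NormedAddCommGroup E] [NormedSpace ℝ E] {V : Set E}
    {F : E → ℝ} (hV : IsOpen V) (hc : Convex ℝ V) (hF : DifferentiableOn ℝ F V) {x y : E}
    (hx : x ∈ V) (hy : y ∈ V) (h : ∀ z ∈ V, fderiv ℝ F z (y - x) = 0) : F y = F x := by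
  obtain ⟨z, hz, he⟩ := domain_mvt (f' := fderiv ℝ F)
    (fun z hz => (hF.differentiableAt (hV.mem_nhds hz)).hasFDerivAt.hasFDerivWithinAt) hc hx hy
  rw [h z (hc.segment_subset hx hy hz)] at he
  linarith

/-- Convexity makes the fibres of `π` in `V` convex, so the mean value theorem gives constancy on
them. Smoothness is read off along the affine section through a given point. -/
theorem exists_factorization {E F : Type*} [NormedAddCommGroup E] [NormedSpace ℝ E]
    [NormedAddCommGroup F] [NormedSpace ℝ F] (π : E →L[ℝ] F) (σ : F →L[ℝ] E)
    (hσ : ∀ y, π (σ y) = y) {V : Set E} {f : E → ℝ} (hV : IsOpen V) (hc : Convex ℝ V)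
    (hf : ContDiffOn ℝ ∞ f V) (h : ∀ z ∈ V, ∀ k, π k = 0 → fderiv ℝ f z k = 0) :
    ∃ g : F → ℝ, ContDiffOn ℝ ∞ g (π '' V) ∧ ∀ z ∈ V, f z = g (π z) := by
  have hfib : ∀ x ∈ V, ∀ y ∈ V, π x = π y → f y = f x := fun x hx y hy hxy =>
    eq_of_fderiv_sub_eq_zero hV hc (hf.differentiableOn (by simp)) hx hy fun z hz =>
      h z hz _ (by rw [map_sub, hxy, sub_self])
  have hex : ∃ g : F → ℝ, ∀ z ∈ V, f z = g (π z) := by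
    refine ⟨fun y => f (Function.invFunOn π V y), fun z hz => ?_⟩
    have hz' : ∃ a ∈ V, π a = π z := ⟨z, hz, rfl⟩
    exact hfib _ (Function.invFunOn_mem hz') _ hz (Function.invFunOn_eq hz')
  obtain ⟨g, hg⟩ := hex
  refine ⟨g, ?_, hg⟩
  rintro _ ⟨z, hz, rfl⟩
  have hl : ContDiff ℝ ∞ fun y => z + σ (y - π z) := by fun_prop
  have hz0 : z + σ (π z - π z) = z := by simp
  have hc1 : ContDiffAt ℝ ∞ (fun y => f (z + σ (y - π z))) (π z) :=
    ContDiffAt.comp (π z) (by rw [hz0]; exact hf.contDiffAt (hV.mem_nhds hz)) hl.contDiffAt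
  refine (hc1.congr_of_eventuallyEq ?_).contDiffWithinAt
  have : ∀ᶠ y in 𝓝 (π z), z + σ (y - π z) ∈ V :=
    hl.continuous.continuousAt.eventually (hV.mem_nhds (by simpa using hz))
  filter_upwards [this] with y hy
  rw [hg _ hy, map_add, hσ]
  simp

/-- A second difference in `u` with increments `s` and `s ^ m` is `F_uu` times their product to
leading order, even though the base point moves with `s`. -/
theorem mixed_difference_isLittleO {W : Set Total} {F : Total → ℝ} (hW : IsOpen W)
    (hF : ContDiffOn ℝ ∞ F W) {b : Base} {u : ℝ} (hp : (b, u) ∈ W) {m : ℕ} (hm : m ≠ 0) :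
    (fun s : ℝ => F ((b.1, b.2 + s), u + s + s ^ m) - F ((b.1, b.2 + s), u + s)
      - (F ((b.1, b.2 + s), u + s ^ m) - F ((b.1, b.2 + s), u))
      - fderiv ℝ (fun z => fderiv ℝ F z (0, 1)) (b, u) (0, 1) * s ^ (m + 1))
      =o[𝓝 0] fun s : ℝ => s ^ (m + 1) := by
  set Fu : Total → ℝ := fun z => fderiv ℝ F z (0, 1) with hFu
  have hFus : ContDiffOn ℝ ∞ Fu W :=
    (hF.fderiv_of_isOpen hW (by simp)).clm_apply contDiffOn_const
  have hst := (hFus.contDiffAt (hW.mem_nhds hp)).hasStrictFDerivAt (by simp)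
  set a := fderiv ℝ Fu (b, u) (0, 1) with ha
  rw [Asymptotics.isLittleO_iff]
  intro ε hε
  have h1 := (Asymptotics.isLittleO_iff.1 hst.isLittleO) hε
  have h2 : ∀ᶠ z in 𝓝 ((b, u) : Total), z ∈ W := hW.mem_nhds hp
  have h3 := h1.and (h2.prodMk_nhds h2)
  rw [Metric.eventually_nhds_iff] at h3
  obtain ⟨δ, hδ, hball⟩ := h3
  have hin : ∀ s v : ℝ, |s| < δ / 2 → |v - u| < δ / 2 →
      |Fu ((b.1, b.2 + s), v + s) - Fu ((b.1, b.2 + s), v) - a * s| ≤ ε * |s| ∧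
      ((b.1, b.2 + s), v + s) ∈ W ∧ ((b.1, b.2 + s), v) ∈ W := by
    intro s v hs hv
    have h4 := @hball (((b.1, b.2 + s), v + s), ((b.1, b.2 + s), v)) (by
      simp only [Prod.dist_eq, dist_self, Real.dist_eq, add_sub_cancel_left]
      have : |v + s - u| < δ := by
        calc |v + s - u| = |(v - u) + s| := by ring_nf
          _ ≤ |v - u| + |s| := abs_add_le _ _
          _ < δ := by linarith
      simp only [max_lt_iff]
      refine ⟨⟨⟨hδ, ?_⟩, this⟩, ⟨hδ, ?_⟩, ?_⟩ <;> linarith)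
    obtain ⟨h5, h6, h7⟩ := h4
    have e : (((b.1, b.2 + s), v + s) : Total) - ((b.1, b.2 + s), v) = s • (0, 1) := by
      ext <;> simp
    simp only [e, map_smul, ← ha, smul_eq_mul, norm_smul] at h5
    refine ⟨?_, h6, h7⟩
    have e2 : ‖((0 : Base), (1 : ℝ))‖ = 1 := by simp [Prod.norm_def]
    rw [e2, mul_one, mul_comm s a] at h5
    exact h5
  have hsmall : ∀ᶠ s : ℝ in 𝓝 0, |s| < δ / 2 ∧ |s| < 1 := by
    have := Metric.ball_mem_nhds (0 : ℝ) (lt_min (half_pos hδ) one_pos)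
    filter_upwards [this] with s hs
    simpa using hs
  filter_upwards [hsmall] with s hs
  have hsm : |s ^ m| < δ / 2 := by
    rw [abs_pow]
    exact (pow_le_of_le_one (abs_nonneg s) hs.2.le hm).trans_lt hs.1
  have hdF : ∀ x : Base, ∀ v : ℝ, (x, v) ∈ W → HasDerivAt (fun v => F (x, v)) (Fu (x, v)) v := by
    intro x v hv
    have h8 := ((hF.contDiffAt (hW.mem_nhds hv)).differentiableAt (by simp)).hasFDerivAt
    exact h8.comp_hasDerivAt v ((hasDerivAt_const v x).prodMk (hasDerivAt_id v))
  -- Mean value inequality in `v` over a step of length `|s| ^ m`. The derivative is bounded by `ε *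
  -- |s|`, thanks to the strict differentiability of `F_u`.
  have hK := (convex_ball u (δ / 2)).norm_image_sub_le_of_norm_hasDerivWithin_le
    (f := fun v => F ((b.1, b.2 + s), v + s) - F ((b.1, b.2 + s), v) - a * s * v)
    (f' := fun v => Fu ((b.1, b.2 + s), v + s) - Fu ((b.1, b.2 + s), v) - a * s)
    (C := ε * |s|) (x := u) (y := u + s ^ m) (fun v hv => by
      rw [Metric.mem_ball, Real.dist_eq] at hv
      obtain ⟨-, h6, h7⟩ := hin s v hs.1 hv
      have h8 := ((hdF _ _ h6).comp_add_const v s).sub (hdF _ _ h7)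
      have h9 := h8.sub ((hasDerivAt_id v).const_mul (a * s))
      rw [mul_one] at h9
      exact h9.hasDerivWithinAt) (fun v hv => by
      rw [Metric.mem_ball, Real.dist_eq] at hv
      exact (hin s v hs.1 hv).1) (by simpa using hδ) (by simpa using hsm)
  have e3 : u + s ^ m + s = u + s + s ^ m := by ring
  simp only [e3] at hK
  rw [pow_succ, norm_mul, Real.norm_eq_abs (s ^ m), Real.norm_eq_abs s]
  refine (le_of_eq ?_).trans (hK.trans (le_of_eq ?_))
  · congr 1; ring
  · rw [add_sub_cancel_left, Real.norm_eq_abs]; ring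

/-! ### The new space variable does not depend on `u`. -/

section components
variable {W : Set Total} {φ : Total → Total}

theorem IsPointTransformation.hasFDerivAt (hφ : IsPointTransformation W φ) {p : Total}
    (hp : p ∈ W) : HasFDerivAt φ (fderiv ℝ φ p) p :=
  ((hφ.2.1.contDiffAt (hφ.1.mem_nhds hp)).differentiableAt (by simp)).hasFDerivAt

theorem IsPointTransformation.fderiv_T (hφ : IsPointTransformation W φ) {p : Total}
    (hp : p ∈ W) (v : Total) :
    fderiv ℝ (fun z => (φ z).1.1) p v = (fderiv ℝ φ p v).1.1 := by
  rw [((hφ.hasFDerivAt hp).fst.fst).fderiv]; rfl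

theorem IsPointTransformation.fderiv_X (hφ : IsPointTransformation W φ) {p : Total}
    (hp : p ∈ W) (v : Total) :
    fderiv ℝ (fun z => (φ z).1.2) p v = (fderiv ℝ φ p v).1.2 := by
  rw [((hφ.hasFDerivAt hp).fst.snd).fderiv]; rfl

theorem IsPointTransformation.fderiv_U (hφ : IsPointTransformation W φ) {p : Total}
    (hp : p ∈ W) (v : Total) :
    fderiv ℝ (fun z => (φ z).2) p v = (fderiv ℝ φ p v).2 := by
  rw [((hφ.hasFDerivAt hp).snd).fderiv]; rfl

end components

section admissible
variable {r : ℕ} {W : Set Total} {φ : Total → Total} {θ θ' : Base → Coeffs r}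

theorem IsAdmissible.T_apply (hr : 2 ≤ r) (h : IsAdmissible r W θ θ' φ) {p : Total} (hp : p ∈ W)
    (v : Total) : (fderiv ℝ φ p v).1.1 = v.1.1 * (fderiv ℝ φ p ((1, 0), 0)).1.1 := by
  obtain ⟨v, z⟩ := v
  rw [total_decomp, map_add, map_add, map_smul, map_smul, map_smul]
  simp [h.fst_fst_eq_zero hr hp]

theorem IsAdmissible.T_ne_zero (hr : 2 ≤ r) (h : IsAdmissible r W θ θ' φ) {p : Total}
    (hp : p ∈ W) : (fderiv ℝ φ p ((1, 0), 0)).1.1 ≠ 0 := by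
  intro h0
  obtain ⟨v, hv⟩ := (h.1.2.2.2 p hp).surjective ((1, 0), 0)
  have := h.T_apply hr hp v
  rw [hv, h0] at this
  simp at this

theorem IsAdmissible.eventually_T_eq (hr : 2 ≤ r) (h : IsAdmissible r W θ θ' φ) {p : Total}
    (hp : p ∈ W) : ∀ᶠ z in 𝓝 p, z.1.1 = p.1.1 → (φ z).1.1 = (φ p).1.1 := by
  obtain ⟨ε, hε, hεW⟩ := Metric.isOpen_iff.1 h.1.1 p hp
  filter_upwards [Metric.ball_mem_nhds p hε] with z hz hzp
  refine eq_of_fderiv_sub_eq_zero (F := fun z => (φ z).1.1) Metric.isOpen_ball (convex_ball p ε)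
    (fun y hy => (h.1.hasFDerivAt (hεW hy)).fst.fst.differentiableAt.differentiableWithinAt)
    (Metric.mem_ball_self hε) hz fun y hy => ?_
  rw [h.1.fderiv_T (hεW hy), h.T_apply hr (hεW hy)]
  simp [hzp]

/-- Transformation law of the leading coefficient. Raising the coefficient of `(x - x₀)ʳ` by 1 must
be compensated by `r! Aʳ` in `u_t`. Lines `t = t₀` go to lines of constant new time, so the images
differ by an explicit multiple of `s ^ r` along them, and the target equation balances the two
effects. -/
theorem IsAdmissible.leading_coeff_eq (hr : 2 ≤ r) (h : IsAdmissible r W θ θ' φ) {p : Total}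
    (hp : p ∈ W) {α : ℝ} (hα : (fderiv ℝ φ p ((0, 1), α)).1.2 ≠ 0) :
    (fderiv ℝ φ p ((1, 0), 0)).1.1 * (θ' (φ p).1).A (Fin.last r)
      = (θ p.1).A (Fin.last r) * (fderiv ℝ φ p ((0, 1), α)).1.2 ^ r := by
  obtain ⟨b, u⟩ := p
  have hφ := h.1
  have hfac : (r.factorial : ℝ) ≠ 0 := by positivity
  have hnd : ∀ τ : ℝ, ∀ v : Base, (fderiv ℝ φ (b, u) (v, τ * v.1 + α * v.2)).1 = 0 → v = 0 := by
    intro τ v hv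
    have h1 : v.1 = 0 := by
      have := h.T_apply hr hp (v, τ * v.1 + α * v.2)
      rw [hv] at this
      exact (mul_eq_zero.1 this.symm).resolve_right (h.T_ne_zero hr hp)
    have h2 : ((v, τ * v.1 + α * v.2) : Total) = v.2 • ((0, 1), α) := by
      ext <;> simp [h1, mul_comm]
    rw [h2, map_smul] at hv
    have h3 : v.2 * (fderiv ℝ φ (b, u) ((0, 1), α)).1.2 = 0 := by
      simpa using congrArg Prod.snd hv
    exact Prod.ext h1 ((mul_eq_zero.1 h3).resolve_right hα)
  -- Here the equation at `b` is solved for `u_t`, which enters with coefficient 1.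
  have hsol : ∀ β : ℝ, ∃ τ, linearPart (θ b) u (testFun b u τ α β r) b = (θ b).B := by
    intro β
    refine ⟨(θ b).B - u * linearPart (θ b) u (monX 0 b) b - α * linearPart (θ b) u (monX 1 b) b
      - β * linearPart (θ b) u (monX r b) b, ?_⟩
    rw [linearPart_testFun]; ring
  have hpair : ∀ τ β : ℝ, ∃ g, IsPaired φ (testFun b u τ α β r) g b := by
    intro τ β
    refine exists_isPaired hφ (contDiff_testFun ..) ?_ fun v => ?_
    · rwa [testFun_self _ _ _ _ _ _ (by omega)]
    · rw [testFun_self _ _ _ _ _ _ (by omega), fderiv_testFun, if_neg (by omega), add_zero]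
      exact hnd τ v
  obtain ⟨τ₁, hτ₁⟩ := hsol 0
  obtain ⟨τ₂, hτ₂⟩ := hsol 1
  obtain ⟨g₁, hp₁⟩ := hpair τ₁ 0
  obtain ⟨g₂, hp₂⟩ := hpair τ₂ 1
  have hτ : τ₁ - τ₂ = -((θ b).A (Fin.last r) * r.factorial) := by
    rw [linearPart_testFun] at hτ₁ hτ₂
    rw [← linearPart_monX_self hr (θ b) u b]
    linarith
  set f₁ := testFun b u τ₁ α 0 r with hf₁
  set f₂ := testFun b u τ₂ α 1 r with hf₂
  have hb₁ : f₁ b = u := testFun_self _ _ _ _ _ _ (by omega)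
  have hb₂ : f₂ b = u := testFun_self _ _ _ _ _ _ (by omega)
  have hs₁ := (h.2.2.2.linearPart_iff (by omega) hp₁ (by rwa [hb₁])).1 (by rwa [hb₁])
  have hs₂ := (h.2.2.2.linearPart_iff (by omega) hp₂ (by rwa [hb₂])).1 (by rwa [hb₂])
  obtain ⟨κ, hκ, ho⟩ := hp₁.exists_sub_isLittleO hφ hp₂ (by rw [hb₁, hb₂]) (by rwa [hb₁])
  have hψ := hasFDerivAt_baseMap hφ hp₁.1 (b := b) (by rwa [hb₁])
  have hGs : ContDiff ℝ ∞ (g₁ - g₂) := smooth_sub hp₁.2.1 hp₂.2.1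
  rw [hb₁] at hs₁ hψ
  rw [hb₂] at hs₂
  have hG0 : (g₁ - g₂) (φ (b, u)).1 = 0 := by
    have e₁ := hp₁.2.2.self_of_nhds
    have e₂ := hp₂.2.2.self_of_nhds
    rw [hb₁] at e₁
    rw [hb₂] at e₂
    simp [← e₁, ← e₂]
  have hT := h.eventually_T_eq hr hp
  have hTt : ∀ v, (fderiv ℝ φ (b, u) v).1.1 = v.1.1 * (fderiv ℝ φ (b, u) ((1, 0), 0)).1.1 :=
    h.T_apply hr hp
  dsimp only at hT hα ⊢
  set q := (φ (b, u)).1 with hq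
  -- the restriction to the line `t = t₀`
  have hline : HasDerivAt (fun s : ℝ => ((b.1, b.2 + s) : Base)) (0, 1) 0 :=
    (hasDerivAt_const _ _).prodMk ((hasDerivAt_id _).const_add _)
  have hline0 : ((b.1, b.2 + 0) : Base) = b := by simp
  have hf₁' : fderiv ℝ f₁ b (0, 1) = α := by
    rw [hf₁, fderiv_testFun]; simp
  have hξ : HasDerivAt (fun s : ℝ => (φ ((b.1, b.2 + s), f₁ (b.1, b.2 + s))).1.2)
      (fderiv ℝ φ (b, u) ((0, 1), α)).1.2 0 := by
    have h1 := (hasFDerivAt_snd.comp b hψ).comp_hasDerivAt_of_eq (0 : ℝ) hline (by simp)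
    have h2 := h1
    simp only [ContinuousLinearMap.comp_apply, ContinuousLinearMap.prod_apply, hf₁'] at h2
    exact h2
  have hx := dx_eq_of_isLittleO (q := q) (c := -κ) (r := r) hGs hξ
    (by simp only [hline0, hb₁, hq]) hα (by
      have h1 := ho.comp_tendsto (k := fun s : ℝ => ((b.1, b.2 + s) : Base)) (l' := 𝓝 0) (by
        have := hline.continuousAt.tendsto
        rwa [hline0] at this)
      have hc : Tendsto (fun s : ℝ => (((b.1, b.2 + s), f₁ (b.1, b.2 + s)) : Total)) (𝓝 0)
          (𝓝 (b, u)) := by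
        have h2 : Continuous fun s : ℝ => (((b.1, b.2 + s), f₁ (b.1, b.2 + s)) : Total) := by
          have := hp₁.1.continuous
          fun_prop
        have h3 := h2.tendsto 0
        rwa [hline0, hb₁] at h3
      have h4 : ∀ s : ℝ, f₁ (b.1, b.2 + s) - f₂ (b.1, b.2 + s) = -s ^ r := by
        intro s
        rw [hf₁, hf₂, testFun_apply, testFun_apply]
        simp
      simp only [Function.comp_def, h4] at h1
      refine (h1.trans_isBigO (Asymptotics.isBigO_refl _ _).neg_left).congr' ?_ .rfl
      filter_upwards [hc.eventually hT] with s hs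
      have h5 : (φ ((b.1, b.2 + s), f₁ (b.1, b.2 + s))).1
          = (q.1, (φ ((b.1, b.2 + s), f₁ (b.1, b.2 + s))).1.2) := Prod.ext (hs rfl) rfl
      rw [← h5]
      ring)
  -- the derivative in `t`
  have ht : (fderiv ℝ φ (b, u) ((1, 0), 0)).1.1 * dt (g₁ - g₂) q = κ * (τ₁ - τ₂) := by
    have h0 : HasFDerivAt (g₁ - g₂) (fderiv ℝ (g₁ - g₂) q) (φ (b, f₁ b)).1 := by
      rw [hb₁]
      exact (hGs.differentiable (by simp) q).hasFDerivAt
    have h1 := h0.comp b hψ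
    have h2 := ((hp₁.1.differentiable (by simp) b).hasFDerivAt.sub
      (hp₂.1.differentiable (by simp) b).hasFDerivAt).const_mul κ
    have h3 : HasFDerivAt (fun a => (g₁ - g₂) (φ (a, f₁ a)).1 - κ * (f₁ a - f₂ a))
        (0 : Base →L[ℝ] ℝ) b := by
      refine .of_isLittleO ?_
      have h4 : (fun a => f₁ a - f₂ a) =O[𝓝 b] fun a => a - b := by
        have := (hp₁.1.sub hp₂.1).differentiable (by simp) b
        simpa [hb₁, hb₂] using this.isBigO_sub
      refine (ho.trans_isBigO h4).congr_left fun a => ?_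
      simp only [hb₁, hb₂, ← hq, hG0]
      simp
    have h5 := congrArg (fun L => L (1, 0)) ((h1.sub h2).unique h3)
    simp only [sub_apply, ContinuousLinearMap.comp_apply, ContinuousLinearMap.prod_apply,
      smul_apply, zero_apply, smul_eq_mul, ContinuousLinearMap.coe_fst',
      ContinuousLinearMap.coe_id', id] at h5
    rw [fderiv_apply_eq hGs, hTt, hx.1 1 (by omega), hf₁, hf₂, fderiv_testFun, fderiv_testFun]
      at h5
    simp at h5
    linarith
  have hL : linearPart (θ' q) (φ (b, u)).2 (g₁ - g₂) q = 0 := by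
    rw [linearPart_sub _ _ hp₁.2.1 hp₂.2.1, hs₁, hs₂, sub_self]
  rw [linearPart_eq_of_dx_eq_zero hr _ _ hx.1] at hL
  rw [hτ] at ht
  have hx2 := hx.2
  refine mul_left_cancel₀ (mul_ne_zero hκ hfac) ?_
  linear_combination ((θ' q).A (Fin.last r) * (fderiv ℝ φ (b, u) ((1, 0), 0)).1.1) * hx2
    - (fderiv ℝ φ (b, u) ((0, 1), α)).1.2 ^ r * ht
    + (fderiv ℝ φ (b, u) ((0, 1), α)).1.2 ^ r * (fderiv ℝ φ (b, u) ((1, 0), 0)).1.1 * hL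

/-- In `leading_coeff_eq` only `D_x X = X_x + α X_u` depends on `α`. If `X_u ≠ 0`, it takes the
values 1 and 2, forcing `1 = 2 ^ r`. -/
theorem IsAdmissible.X_u_eq_zero (hr : 2 ≤ r) (h : IsAdmissible r W θ θ' φ) {p : Total}
    (hp : p ∈ W) : (fderiv ℝ φ p ((0, 0), 1)).1.2 = 0 := by
  by_contra hne
  have hap : ∀ α : ℝ, (fderiv ℝ φ p ((0, 1), α)).1.2
      = (fderiv ℝ φ p ((0, 1), 0)).1.2 + α * (fderiv ℝ φ p ((0, 0), 1)).1.2 := by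
    intro α
    have : (((0, 1), α) : Total) = ((0, 1), 0) + α • ((0, 0), 1) := by ext <;> simp
    rw [this, map_add, map_smul]
    simp
  have hval : ∀ d : ℝ, ∃ α : ℝ, (fderiv ℝ φ p ((0, 1), α)).1.2 = d := fun d =>
    ⟨(d - (fderiv ℝ φ p ((0, 1), 0)).1.2) / (fderiv ℝ φ p ((0, 0), 1)).1.2, by
      rw [hap, div_mul_cancel₀ _ hne]; ring⟩
  obtain ⟨α₁, h₁⟩ := hval 1
  obtain ⟨α₂, h₂⟩ := hval 2
  have e₁ := h.leading_coeff_eq hr hp (α := α₁) (by rw [h₁]; norm_num)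
  have e₂ := h.leading_coeff_eq hr hp (α := α₂) (by rw [h₂]; norm_num)
  rw [e₁, h₁, h₂] at e₂
  have := mul_left_cancel₀ (A_last_ne_zero (h.regular_left hp)) e₂
  have h3 : (1 : ℝ) < 2 ^ r := one_lt_pow₀ (by norm_num) (by omega)
  rw [one_pow] at this
  linarith

end admissible

/-! ### The new unknown function is affine in `u`. -/

section admissible
variable {r : ℕ} {W : Set Total} {φ : Total → Total} {θ θ' : Base → Coeffs r}

theorem IsAdmissible.X_apply (hr : 2 ≤ r) (h : IsAdmissible r W θ θ' φ) {p : Total} (hp : p ∈ W)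
    (v : Total) : (fderiv ℝ φ p v).1.2
      = v.1.1 * (fderiv ℝ φ p ((1, 0), 0)).1.2 + v.1.2 * (fderiv ℝ φ p ((0, 1), 0)).1.2 := by
  obtain ⟨v, z⟩ := v
  rw [total_decomp, map_add, map_add, map_smul, map_smul, map_smul]
  simp [h.X_u_eq_zero hr hp]

theorem IsAdmissible.X_x_ne_zero (hr : 2 ≤ r) (h : IsAdmissible r W θ θ' φ) {p : Total}
    (hp : p ∈ W) : (fderiv ℝ φ p ((0, 1), 0)).1.2 ≠ 0 := by
  intro h0
  obtain ⟨v, hv⟩ := (h.1.2.2.2 p hp).surjective ((0, 1), 0)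
  have h1 := h.T_apply hr hp v
  have h2 := h.X_apply hr hp v
  rw [hv] at h1 h2
  have h3 : v.1.1 = 0 := (mul_eq_zero.1 h1.symm).resolve_right (h.T_ne_zero hr hp)
  simp [h3, h0] at h2

theorem IsAdmissible.fst_injective (hr : 2 ≤ r) (h : IsAdmissible r W θ θ' φ) {p : Total}
    (hp : p ∈ W) {v : Base} {z : ℝ} (hv : (fderiv ℝ φ p (v, z)).1 = 0) : v = 0 := by
  have h1 := h.T_apply hr hp (v, z)
  have h2 := h.X_apply hr hp (v, z)
  rw [hv] at h1 h2
  have h3 : v.1 = 0 := (mul_eq_zero.1 h1.symm).resolve_right (h.T_ne_zero hr hp)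
  dsimp only [Prod.snd_zero] at h2
  rw [h3, zero_mul, zero_add] at h2
  exact Prod.ext h3 ((mul_eq_zero.1 h2.symm).resolve_right (h.X_x_ne_zero hr hp))

theorem IsAdmissible.U_u_ne_zero (hr : 2 ≤ r) (h : IsAdmissible r W θ θ' φ) {p : Total}
    (hp : p ∈ W) : (fderiv ℝ φ p (0, 1)).2 ≠ 0 := by
  intro h0
  have h1 := h.T_apply hr hp (0, 1)
  have h2 := h.X_apply hr hp (0, 1)
  have h3 : fderiv ℝ φ p (0, 1) = 0 := by
    refine Prod.ext (Prod.ext ?_ ?_) h0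
    · simpa using h1
    · simpa using h2
  have := (h.1.2.2.2 p hp).injective (h3.trans (map_zero _).symm)
  simp at this

theorem IsAdmissible.exists_isPaired (hr : 2 ≤ r) (h : IsAdmissible r W θ θ' φ) {f : Base → ℝ}
    (hf : ContDiff ℝ ∞ f) {b : Base} (hb : (b, f b) ∈ W) : ∃ g, IsPaired φ f g b :=
  BurgersKdV.exists_isPaired h.1 hf hb fun _ hv => h.fst_injective hr hb hv

theorem IsAdmissible.eventually_base_eq (hr : 2 ≤ r) (h : IsAdmissible r W θ θ' φ) {p : Total}
    (hp : p ∈ W) : ∀ᶠ z in 𝓝 p, z.1.1 = p.1.1 →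
      (φ z).1 = ((φ p).1.1, (φ (z.1, p.2)).1.2) := by
  obtain ⟨ε, hε, hεW⟩ := Metric.isOpen_iff.1 h.1.1 p hp
  filter_upwards [Metric.ball_mem_nhds p hε, h.eventually_T_eq hr hp] with z hz hT hzp
  refine Prod.ext (hT hzp) ?_
  have hz' : (z.1, p.2) ∈ Metric.ball p ε := by
    rw [Metric.mem_ball, Prod.dist_eq, max_lt_iff] at hz ⊢
    exact ⟨hz.1, by simpa using hε⟩
  refine eq_of_fderiv_sub_eq_zero (F := fun z => (φ z).1.2) Metric.isOpen_ball (convex_ball p ε)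
    (fun y hy => (h.1.hasFDerivAt (hεW hy)).fst.snd.differentiableAt.differentiableWithinAt)
    hz' hz fun y hy => ?_
  rw [h.1.fderiv_X (hεW hy), h.X_apply hr (hεW hy)]
  simp

/-- Let `G` be the mixed second difference of the images of four functions with increments `x - x₀`
and `(x - x₀)ʳ⁻¹`. The product of the increments has order exactly `r`, so `U_uu` appears precisely
in `∂ₓʳ G`, while `G_t` and the lower `x`-derivatives vanish; the target equation then forces `U_uu
= 0`. -/
theorem IsAdmissible.U_uu_eq_zero (hr : 2 ≤ r) (h : IsAdmissible r W θ θ' φ) {p : Total}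
    (hp : p ∈ W) :
    fderiv ℝ (fun z => fderiv ℝ (fun z => (φ z).2) z (0, 1)) p (0, 1) = 0 := by
  obtain ⟨b, u⟩ := p
  have hφ := h.1
  have hfac : (r.factorial : ℝ) ≠ 0 := by positivity
  have hr1 : r - 1 ≠ 0 := by omega
  -- The value of `u_t` required by the equation is affine in `i` and `j` without a mixed term, so
  -- it drops out of the mixed difference.
  let τ : ℝ → ℝ → ℝ := fun i j => (θ b).B - u * linearPart (θ b) u (monX 0 b) b
    - i * linearPart (θ b) u (monX 1 b) b - j * linearPart (θ b) u (monX (r - 1) b) b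
  let f : ℝ → ℝ → Base → ℝ := fun i j => testFun b u (τ i j) i j (r - 1)
  have hfs : ∀ i j, ContDiff ℝ ∞ (f i j) := fun i j => contDiff_testFun ..
  have hfb : ∀ i j, f i j b = u := fun i j => testFun_self _ _ _ _ _ _ hr1
  have hfsol : ∀ i j, linearPart (θ b) (f i j b) (f i j) b = (θ b).B := by
    intro i j
    rw [hfb, linearPart_testFun]
    ring
  have hW : ∀ i j, (b, f i j b) ∈ W := fun i j => by rwa [hfb]
  choose g hg using fun i j => h.exists_isPaired hr (hfs i j) (hW i j)
  have hgs : ∀ i j, ContDiff ℝ ∞ (g i j) := fun i j => (hg i j).2.1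
  have hgsol : ∀ i j, linearPart (θ' (φ (b, u)).1) (φ (b, u)).2 (g i j) (φ (b, u)).1
      = (θ' (φ (b, u)).1).B := by
    intro i j
    have := (h.2.2.2.linearPart_iff (by omega) (hg i j) (hW i j)).1 (hfsol i j)
    rwa [hfb] at this
  have hgd : ∀ i j, (fderiv ℝ φ (b, u) ((1, 0), 0)).1.1 * dt (g i j) (φ (b, u)).1
      + (fderiv ℝ φ (b, u) ((1, 0), 0)).1.2 * dx 1 (g i j) (φ (b, u)).1
      = (fderiv ℝ φ (b, u) ((1, 0), 0)).2 + τ i j * (fderiv ℝ φ (b, u) (0, 1)).2 := by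
    intro i j
    have h1 := (hg i j).fderiv_eq hφ (hW i j) (1, 0)
    rw [hfb, fderiv_apply_eq (hgs i j), h.T_apply hr hp, h.X_apply hr hp] at h1
    have h2 : (((1, 0), fderiv ℝ (f i j) b (1, 0)) : Total)
        = ((1, 0), 0) + τ i j • (0, 1) := by
      simp only [f]
      rw [fderiv_testFun]
      ext <;> simp
    rw [h2, map_add, map_smul] at h1
    simp at h1
    linarith
  let G := (g 1 1 - g 1 0) - (g 0 1 - g 0 0)
  have hs₁ := smooth_sub (hgs 1 1) (hgs 1 0)
  have hs₀ := smooth_sub (hgs 0 1) (hgs 0 0)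
  have hGs : ContDiff ℝ ∞ G := smooth_sub hs₁ hs₀
  have hL : linearPart (θ' (φ (b, u)).1) (φ (b, u)).2 G (φ (b, u)).1 = 0 := by
    simp only [G]
    rw [linearPart_sub _ _ hs₁ hs₀, linearPart_sub _ _ (hgs _ _) (hgs _ _),
      linearPart_sub _ _ (hgs _ _) (hgs _ _)]
    simp [hgsol]
  have hGd : (fderiv ℝ φ (b, u) ((1, 0), 0)).1.1 * dt G (φ (b, u)).1
      + (fderiv ℝ φ (b, u) ((1, 0), 0)).1.2 * dx 1 G (φ (b, u)).1 = 0 := by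
    simp only [G]
    rw [dt_sub hs₁ hs₀, dx_sub _ hs₁ hs₀, dt_sub (hgs _ _) (hgs _ _), dt_sub (hgs _ _) (hgs _ _),
      dx_sub _ (hgs _ _) (hgs _ _), dx_sub _ (hgs _ _) (hgs _ _)]
    simp only [τ] at hgd
    linear_combination hgd 1 1 - hgd 1 0 - hgd 0 1 + hgd 0 0
  have hline : HasDerivAt (fun s : ℝ => (((b.1, b.2 + s), u) : Total)) ((0, 1), 0) 0 :=
    ((hasDerivAt_const _ _).prodMk ((hasDerivAt_id _).const_add _)).prodMk (hasDerivAt_const _ _)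
  have hξ : HasDerivAt (fun s : ℝ => (φ ((b.1, b.2 + s), u)).1.2)
      (fderiv ℝ φ (b, u) ((0, 1), 0)).1.2 0 :=
    (hφ.hasFDerivAt hp).fst.snd.comp_hasDerivAt_of_eq (0 : ℝ) hline (by simp)
  have hU : ContDiffOn ℝ ∞ (fun z => (φ z).2) W := hφ.2.1.snd
  have hmix := mixed_difference_isLittleO hφ.1 hU hp hr1
  rw [Nat.sub_add_cancel (by omega : 1 ≤ r)] at hmix
  set a := fderiv ℝ (fun z => fderiv ℝ (fun z => (φ z).2) z (0, 1)) (b, u) (0, 1)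
  have hval : ∀ i j, ∀ᶠ s : ℝ in 𝓝 0,
      (φ ((b.1, b.2 + s), u + i * s + j * s ^ (r - 1))).2
        = g i j ((φ (b, u)).1.1, (φ ((b.1, b.2 + s), u)).1.2) := by
    intro i j
    have hc : Continuous fun s : ℝ => ((b.1, b.2 + s) : Base) := by fun_prop
    have hc0 := hc.tendsto 0
    have hd : Continuous fun s : ℝ => (((b.1, b.2 + s), f i j (b.1, b.2 + s)) : Total) :=
      hc.prodMk ((hfs i j).continuous.comp hc)
    have hd0 := hd.tendsto 0
    simp only [add_zero, Prod.mk.eta, hfb] at hc0 hd0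
    filter_upwards [hc0.eventually (hg i j).2.2, hd0.eventually (h.eventually_base_eq hr hp)]
      with s h1 h2
    have h3 := h2 rfl
    rw [h3] at h1
    rw [← h1]
    simp [f, testFun_apply]
  have hx := dx_eq_of_isLittleO (q := (φ (b, u)).1) (c := a) (r := r) hGs hξ (by simp)
    (h.X_x_ne_zero hr hp) (by
      refine hmix.congr' ?_ .rfl
      filter_upwards [hval 1 1, hval 1 0, hval 0 1, hval 0 0] with s h11 h10 h01 h00
      simp only [one_mul, zero_mul, add_zero] at h11 h10 h01 h00
      rw [h11, h10, h01, h00]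
      rfl)
  rw [linearPart_eq_of_dx_eq_zero hr _ _ hx.1] at hL
  rw [hx.1 1 (by omega), mul_zero, add_zero] at hGd
  rw [(mul_eq_zero.1 hGd).resolve_left (h.T_ne_zero hr hp), zero_sub, neg_eq_zero] at hL
  have hx2 := hx.2
  rw [(mul_eq_zero.1 hL).resolve_left (A_last_ne_zero (h.regular_right hp)), zero_mul] at hx2
  exact (mul_eq_zero.1 hx2.symm).resolve_left hfac

theorem IsAdmissible.exists_affine (hr : 2 ≤ r) (h : IsAdmissible r W θ θ' φ)
    (hc : Convex ℝ W) : ∃ (T : ℝ → ℝ) (X U1 U0 : Base → ℝ),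
      ContDiffOn ℝ ∞ T ((fun p : Total => p.1.1) '' W) ∧ ContDiffOn ℝ ∞ X (Prod.fst '' W) ∧
      ContDiffOn ℝ ∞ U1 (Prod.fst '' W) ∧ ContDiffOn ℝ ∞ U0 (Prod.fst '' W) ∧
      ∀ p ∈ W, φ p = ((T p.1.1, X p.1), U1 p.1 * p.2 + U0 p.1) := by
  have hφ := h.1
  have hW := hφ.1
  let π := ContinuousLinearMap.fst ℝ Base ℝ
  let σ := ContinuousLinearMap.inl ℝ Base ℝ
  have hσ : ∀ y, π (σ y) = y := fun y => rfl
  have hker : ∀ k : Total, π k = 0 → k = k.2 • (0, 1) := by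
    rintro ⟨k, z⟩ hk
    have : k = 0 := hk
    ext <;> simp [this]
  obtain ⟨T, hT, hT'⟩ := exists_factorization ((ContinuousLinearMap.fst ℝ ℝ ℝ).comp π)
    (σ.comp (ContinuousLinearMap.inl ℝ ℝ ℝ)) (fun y => rfl) hW hc hφ.2.1.fst.fst (by
      intro z hz k hk
      rw [hφ.fderiv_T hz, h.T_apply hr hz]
      exact mul_eq_zero_of_left hk _)
  obtain ⟨X, hX, hX'⟩ := exists_factorization π σ hσ hW hc hφ.2.1.fst.snd (by
      intro z hz k hk
      rw [hφ.fderiv_X hz, h.X_apply hr hz, hker k hk]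
      simp)
  have hU : ContDiffOn ℝ ∞ (fun z => (φ z).2) W := hφ.2.1.snd
  have hUu : ContDiffOn ℝ ∞ (fun z => fderiv ℝ (fun z => (φ z).2) z (0, 1)) W :=
    (hU.fderiv_of_isOpen hW (by simp)).clm_apply contDiffOn_const
  obtain ⟨U1, hU1, hU1'⟩ := exists_factorization π σ hσ hW hc hUu (by
      intro z hz k hk
      rw [hker k hk, map_smul, h.U_uu_eq_zero hr hz, smul_zero])
  have hmaps : MapsTo π W (π '' W) := mapsTo_image _ _
  have hU1c : ContDiffOn ℝ ∞ (fun z : Total => U1 z.1) W :=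
    hU1.comp π.contDiff.contDiffOn hmaps
  obtain ⟨U0, hU0, hU0'⟩ := exists_factorization (f := fun z => (φ z).2 - U1 z.1 * z.2)
    π σ hσ hW hc (hU.sub (hU1c.mul contDiff_snd.contDiffOn)) (by
      intro z hz k hk
      have hbase : IsOpen (π '' W) := isOpenMap_fst W hW
      have h1 := ((hU.contDiffAt (hW.mem_nhds hz)).differentiableAt (by simp)).hasFDerivAt
      have h2 := ((hU1.contDiffAt (hbase.mem_nhds (hmaps hz))).differentiableAt
        (by simp)).hasFDerivAt.comp z (hasFDerivAt_fst (p := z))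
      have h3 := h1.sub (h2.mul hasFDerivAt_snd)
      have h4 := hU1' z hz
      have h5 : fderiv ℝ (fun z => (φ z).2 - U1 z.1 * z.2) z = _ := HasFDerivAt.fderiv h3
      rw [h5, hker k hk, map_smul, sub_apply, h4]
      simp [π])
  refine ⟨T, X, U1, U0, hT, hX, hU1, hU0, fun p hp => Prod.ext (Prod.ext (hT' p hp) (hX' p hp)) ?_⟩
  have := hU0' p hp
  change (φ p).2 - U1 p.1 * p.2 = U0 p.1 at this
  change (φ p).2 = _
  linarith

/-! ### The coefficient of `u` depends on time only. -/

theorem linearPart_eq_zero_of_eventuallyEq {r : ℕ} (c : Coeffs r) (u : ℝ) {G : Base → ℝ}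
    {q : Base} (hG : G =ᶠ[𝓝 q] 0) : linearPart c u G q = 0 := by
  have h1 : (fun s => G (s, q.2)) =ᶠ[𝓝 q.1] fun _ => 0 := by
    have : ContinuousAt (fun s : ℝ => ((s, q.2) : Base)) q.1 := by fun_prop
    exact this.eventually (p := fun y => G y = 0) hG
  have h2 : (fun s => G (q.1, s)) =ᶠ[𝓝 q.2] fun _ => 0 := by
    have : ContinuousAt (fun s : ℝ => ((q.1, s) : Base)) q.2 := by fun_prop
    exact this.eventually (p := fun y => G y = 0) hG
  have h3 : dt G q = 0 := by rw [dt, h1.deriv_eq, deriv_const]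
  have h4 : ∀ k, dx k G q = 0 := fun k => by
    rw [dx, h2.iteratedDeriv_eq]
    simp
  simp [linearPart, h3, h4]

theorem linearPart_monX_zero {r : ℕ} (c : Coeffs r) (u : ℝ) (b : Base) :
    linearPart c u (monX 0 b) b = linearPart c 0 (monX 0 b) b := by
  simp [linearPart, dx_monX]

theorem linearPart_eq_add {r : ℕ} (c : Coeffs r) (u : ℝ) (f : Base → ℝ) (b : Base) :
    linearPart c u f b = linearPart c 0 f b + c.C * u * dx 1 f b := by
  simp only [linearPart]; ring

/-- Take solution jets over the equally spaced values `u - η`, `u`, `u + η` with `u_x = 0`. Their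
images have vanishing second difference, so everything linear in the target equation cancels. What
survives is the second difference of the product of the new unknown and its `x`-derivative, a
quadratic in `u` with leading coefficient proportional to `U1 * U1_x`. -/
theorem IsAdmissible.U1_x_eq_zero (hr : 2 ≤ r) (h : IsAdmissible r W θ θ' φ)
    {T : ℝ → ℝ} {X U1 U0 : Base → ℝ} (hU1 : ContDiffOn ℝ ∞ U1 (Prod.fst '' W))
    (hU0 : ContDiffOn ℝ ∞ U0 (Prod.fst '' W))
    (heq : ∀ p ∈ W, φ p = ((T p.1.1, X p.1), U1 p.1 * p.2 + U0 p.1)) {p : Total} (hp : p ∈ W) :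
    fderiv ℝ U1 p.1 (0, 1) = 0 := by
  obtain ⟨b, u⟩ := p
  have hφ := h.1
  have hbase : IsOpen (Prod.fst '' W) := isOpenMap_fst W hφ.1
  have hbb : b ∈ Prod.fst '' W := ⟨_, hp, rfl⟩
  obtain ⟨δ, hδ, hδW⟩ := Metric.isOpen_iff.1 hφ.1 _ hp
  have hmem : ∀ i : ℝ, |i| ≤ 1 → (b, u + i * (δ / 2)) ∈ W := by
    intro i hi
    apply hδW
    simp only [Metric.mem_ball, Prod.dist_eq, dist_self, Real.dist_eq, add_sub_cancel_left,
      max_lt_iff]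
    refine ⟨hδ, ?_⟩
    rw [abs_mul, abs_of_pos (half_pos hδ)]
    nlinarith
  set η := δ / 2 with hη
  have hη0 : η ≠ 0 := by positivity
  let τ : ℝ → ℝ := fun i => (θ b).B - (u + i * η) * linearPart (θ b) 0 (monX 0 b) b
  let f : ℝ → Base → ℝ := fun i => testFun b (u + i * η) (τ i) 0 0 1
  have hfs : ∀ i, ContDiff ℝ ∞ (f i) := fun i => contDiff_testFun ..
  have hfb : ∀ i, f i b = u + i * η := fun i => testFun_self _ _ _ _ _ _ one_ne_zero
  have hfsol : ∀ i, linearPart (θ b) (f i b) (f i) b = (θ b).B := by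
    intro i
    rw [hfb, linearPart_testFun, linearPart_monX_zero]
    ring
  have hD : ∀ i : ℝ, |i| ≤ 1 → ∀ v : Base, (fderiv ℝ φ (b, u + i * η) (v, 0)).2
      = fderiv ℝ U1 b v * (u + i * η) + fderiv ℝ U0 b v := by
    intro i hi v
    have h1 : HasFDerivAt U1 (fderiv ℝ U1 b) (b, u + i * η).1 :=
      ((hU1.contDiffAt (hbase.mem_nhds hbb)).differentiableAt (by simp)).hasFDerivAt
    have h2 : HasFDerivAt U0 (fderiv ℝ U0 b) (b, u + i * η).1 :=
      ((hU0.contDiffAt (hbase.mem_nhds hbb)).differentiableAt (by simp)).hasFDerivAt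
    have h3 := ((h1.comp _ hasFDerivAt_fst).mul
      (hasFDerivAt_snd (𝕜 := ℝ) (p := (b, u + i * η)))).add (h2.comp _ hasFDerivAt_fst)
    have h4 : HasFDerivAt (fun z => (φ z).2) _ (b, u + i * η) :=
      h3.congr_of_eventuallyEq (by
        filter_upwards [hφ.1.mem_nhds (hmem i hi)] with z hz
        rw [heq z hz]; rfl)
    rw [← hφ.fderiv_U (hmem i hi), h4.fderiv]
    simp [mul_comm]
  have hXx : ∀ i : ℝ, |i| ≤ 1 → (fderiv ℝ φ (b, u + i * η) ((0, 1), 0)).1.2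
      = deriv (fun y => X (b.1, y)) b.2 := by
    intro i hi
    have h1 : HasDerivAt (fun y : ℝ => (((b.1, y), u + i * η) : Total)) ((0, 1), 0) b.2 :=
      ((hasDerivAt_const _ _).prodMk (hasDerivAt_id _)).prodMk (hasDerivAt_const _ _)
    have h2 := (hφ.hasFDerivAt (hmem i hi)).fst.snd.comp_hasDerivAt b.2 h1
    refine Eq.symm (HasDerivAt.deriv (h2.congr_of_eventuallyEq ?_))
    filter_upwards [h1.continuousAt.eventually (hφ.1.mem_nhds (hmem i hi))] with y hy
    simp [heq _ hy]
  have hloc : ∀ i : ℝ, |i| ≤ 1 → ∃ g : Base → ℝ, ContDiff ℝ ∞ g ∧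
      (∀ᶠ a in 𝓝 b, U1 a * f i a + U0 a = g (T a.1, X a)) ∧
      linearPart (θ' (T b.1, X b)) (U1 b * (u + i * η) + U0 b) g (T b.1, X b)
        = (θ' (T b.1, X b)).B ∧
      fderiv ℝ U1 b (0, 1) * (u + i * η) + fderiv ℝ U0 b (0, 1)
        = deriv (fun y => X (b.1, y)) b.2 * dx 1 g (T b.1, X b) := by
    intro i hi
    have hb : (b, f i b) ∈ W := by rw [hfb]; exact hmem i hi
    obtain ⟨g, hg⟩ := h.exists_isPaired hr (hfs i) hb
    have hcont : ContinuousAt (fun a => ((a, f i a) : Total)) b :=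
      (continuous_id.prodMk (hfs i).continuous).continuousAt
    refine ⟨g, hg.2.1, ?_, ?_, ?_⟩
    · filter_upwards [hg.2.2, hcont.eventually (hφ.1.mem_nhds hb)] with a h1 h2
      rwa [heq _ h2] at h1
    · have := (h.2.2.2.linearPart_iff (by omega) hg hb).1 (hfsol i)
      rwa [heq _ hb, hfb] at this
    · have h1 := hg.fderiv_eq hφ hb (0, 1)
      have h2 : fderiv ℝ (f i) b (0, 1) = 0 := by
        simp only [f]
        rw [fderiv_testFun]; simp
      rw [h2, fderiv_apply_eq hg.2.1, h.T_apply hr hb] at h1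
      rw [hfb, heq _ (hmem i hi), hXx i hi, hD i hi] at h1
      simpa using h1
  obtain ⟨g₀, hg₀, he₀, hl₀, hm₀⟩ := hloc 0 (by simp)
  obtain ⟨g₁, hg₁, he₁, hl₁, hm₁⟩ := hloc 1 (by simp)
  obtain ⟨g₂, hg₂, he₂, hl₂, hm₂⟩ := hloc (-1) (by simp)
  have hb₀ : (b, f 0 b) ∈ W := by rw [hfb]; exact hmem 0 (by simp)
  have hG : (g₁ - g₀) - (g₀ - g₂) =ᶠ[𝓝 ((T b.1, X b) : Base)] 0 := by
    obtain ⟨N, χ, hN, hbN, hχ, hχO, hχ'⟩ := exists_baseMap_localInverse hφ (hfs 0) hb₀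
      fun v hv => h.fst_injective hr hb₀ hv
    have hχb := hχ'.self_of_nhds
    rw [heq _ hb₀] at hbN hχb
    have hcont : ContinuousAt χ (T b.1, X b) := (hχ.contDiffAt (hN.mem_nhds hbN)).continuousAt
    have hall : ∀ᶠ a in 𝓝 (χ (T b.1, X b)), ((g₁ - g₀) - (g₀ - g₂)) (T a.1, X a) = 0 := by
      rw [show χ (T b.1, X b) = b from hχb]
      filter_upwards [he₀, he₁, he₂] with a h0 h1 h2
      simp only [Pi.sub_apply, ← h0, ← h1, ← h2, f, testFun_apply, τ]
      ring
    filter_upwards [hcont.eventually hall, hN.mem_nhds hbN] with q h1 h2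
    obtain ⟨h3, h4⟩ := hχO q h2
    rw [heq _ h3] at h4
    rwa [show (T (χ q).1, X (χ q)) = q from h4] at h1
  -- The frozen value is 0, so that the quadratic terms, which differ between the three equations,
  -- are kept apart.
  have hL := linearPart_eq_zero_of_eventuallyEq (θ' (T b.1, X b)) 0 hG
  rw [linearPart_sub _ _ (smooth_sub hg₁ hg₀) (smooth_sub hg₀ hg₂),
    linearPart_sub _ _ hg₁ hg₀, linearPart_sub _ _ hg₀ hg₂] at hL
  rw [linearPart_eq_add] at hl₀ hl₁ hl₂
  have hC : (θ' (T b.1, X b)).C ≠ 0 := by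
    have := C_ne_zero (h.regular_right hp)
    rwa [heq _ hp] at this
  have hU1b : U1 b ≠ 0 := by
    have h1 : HasDerivAt (fun v : ℝ => ((b, v) : Total)) (0, 1) u :=
      (hasDerivAt_const _ _).prodMk (hasDerivAt_id _)
    have h2 := (hφ.hasFDerivAt hp).snd.comp_hasDerivAt u h1
    have h3 : HasDerivAt (fun v : ℝ => U1 b * v + U0 b) (U1 b * 1) u :=
      ((hasDerivAt_id u).const_mul (U1 b)).add_const (U0 b)
    have h4 := h2.unique (h3.congr_of_eventuallyEq (by
      filter_upwards [h1.continuousAt.eventually (hφ.1.mem_nhds hp)] with y hy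
      simp [heq _ hy]))
    have h5 := h.U_u_ne_zero hr hp
    intro h0
    rw [h0, zero_mul] at h4
    exact h5 h4
  have key : (θ' (T b.1, X b)).C * U1 b * (2 * η ^ 2) * fderiv ℝ U1 b (0, 1) = 0 := by
    generalize deriv (fun y => X (b.1, y)) b.2 = x at *
    generalize fderiv ℝ U1 b (0, 1) = m at *
    generalize fderiv ℝ U0 b (0, 1) = n at *
    generalize dx 1 g₀ (T b.1, X b) = d₀ at *
    generalize dx 1 g₁ (T b.1, X b) = d₁ at *
    generalize dx 1 g₂ (T b.1, X b) = d₂ at *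
    generalize (θ' (T b.1, X b)).C = c at *
    linear_combination x * hl₁ + x * hl₂ - 2 * x * hl₀ - x * hL
      + c * (U1 b * (u + η) + U0 b) * hm₁ + c * (U1 b * (u - η) + U0 b) * hm₂
      - 2 * c * (U1 b * u + U0 b) * hm₀
  exact (mul_eq_zero.1 key).resolve_left (mul_ne_zero (mul_ne_zero hC hU1b) (by positivity))

end admissible

/-! ### Admissible transformations over convex domains have the fibre-affine form. -/

theorem hasDerivAt_snd_slice {X : Base → ℝ} {b : Base} (hX : DifferentiableAt ℝ X b) :
    HasDerivAt (fun y => X (b.1, y)) (fderiv ℝ X b (0, 1)) b.2 := by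
  have h2 : HasDerivAt (fun s : ℝ => ((b.1, s) : Base)) (0, 1) b.2 :=
    (hasDerivAt_const _ _).prodMk (hasDerivAt_id _)
  exact hX.hasFDerivAt.comp_hasDerivAt b.2 h2

theorem hasDerivAt_fst_slice {X : Base → ℝ} {b : Base} (hX : DifferentiableAt ℝ X b) :
    HasDerivAt (fun s => X (s, b.2)) (fderiv ℝ X b (1, 0)) b.1 := by
  have h2 : HasDerivAt (fun s : ℝ => ((s, b.2) : Base)) (1, 0) b.1 :=
    (hasDerivAt_id _).prodMk (hasDerivAt_const _ _)
  exact hX.hasFDerivAt.comp_hasDerivAt b.1 h2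

section fiberAffine
variable {V : Set Total} {T : ℝ → ℝ} {X : Base → ℝ} {U1 : ℝ → ℝ} {U0 : Base → ℝ}

theorem isOpen_time (hV : IsOpen V) : IsOpen ((fun p : Total => p.1.1) '' V) := by
  have := isOpenMap_fst (X := ℝ) (Y := ℝ) _ (isOpenMap_fst (X := Base) (Y := ℝ) V hV)
  rwa [image_image] at this

theorem isOpen_base (hV : IsOpen V) : IsOpen (Prod.fst '' V) := isOpenMap_fst V hV

theorem differentiableAt_and_fderiv_fiberAffine {p : Total} (hT : DifferentiableAt ℝ T p.1.1)
    (hX : DifferentiableAt ℝ X p.1) (hU1 : DifferentiableAt ℝ U1 p.1.1)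
    (hU0 : DifferentiableAt ℝ U0 p.1) :
    DifferentiableAt ℝ (fiberAffine T X U1 U0) p ∧
      ∀ v : Total, fderiv ℝ (fiberAffine T X U1 U0) p v
        = ((deriv T p.1.1 * v.1.1, fderiv ℝ X p.1 v.1),
          deriv U1 p.1.1 * v.1.1 * p.2 + U1 p.1.1 * v.2 + fderiv ℝ U0 p.1 v.1) := by
  have ht : HasFDerivAt (fun p : Total => p.1.1) _ p := (hasFDerivAt_id (𝕜 := ℝ) p).fst.fst
  have hb : HasFDerivAt (fun p : Total => p.1) _ p := (hasFDerivAt_id (𝕜 := ℝ) p).fst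
  have hu : HasFDerivAt (fun p : Total => p.2) _ p := (hasFDerivAt_id (𝕜 := ℝ) p).snd
  have h1 := (hT.hasDerivAt.comp_hasFDerivAt p ht).prodMk (hX.hasFDerivAt.comp p hb)
  have h2 := ((hU1.hasDerivAt.comp_hasFDerivAt p ht).mul hu).add (hU0.hasFDerivAt.comp p hb)
  have h3 : HasFDerivAt (fiberAffine T X U1 U0) _ p := h1.prodMk h2
  refine ⟨h3.differentiableAt, fun v => ?_⟩
  rw [h3.fderiv]
  ext
  · simp
  · simp
  · simp; ring

end fiberAffine

theorem IsAdmissible.exists_eqOn_fiberAffine {r : ℕ} {V : Set Total} {φ : Total → Total}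
    {θ θ' : Base → Coeffs r} (hr : 2 ≤ r) (h : IsAdmissible r V θ θ' φ) (hc : Convex ℝ V) :
    ∃ (T : ℝ → ℝ) (X : Base → ℝ) (U1 : ℝ → ℝ) (U0 : Base → ℝ),
      AreParameters V T X U1 U0 ∧ EqOn φ (fiberAffine T X U1 U0) V := by
  obtain ⟨T, X, V1, U0, hT, hX, hV1, hU0, heq⟩ := h.exists_affine hr hc
  have hV := h.1.1
  have hbase := isOpen_base hV
  have htime := isOpen_time hV
  obtain ⟨U1, hU1, hU1'⟩ := exists_factorization (ContinuousLinearMap.fst ℝ ℝ ℝ)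
    (ContinuousLinearMap.inl ℝ ℝ ℝ) (fun y => rfl) hbase
    (hc.linear_image (LinearMap.fst ℝ Base ℝ)) hV1 (by
      rintro _ ⟨p, hp, rfl⟩ k hk
      have h1 : k = k.2 • (0, 1) := by
        have : k.1 = 0 := hk
        ext <;> simp [this]
      rw [h1, map_smul, h.U1_x_eq_zero hr hV1 hU0 heq hp, smul_zero])
  have himg : ContinuousLinearMap.fst ℝ ℝ ℝ '' (Prod.fst '' V) = (fun p : Total => p.1.1) '' V := by
    rw [image_image]; rfl
  rw [himg] at hU1
  have heq' : EqOn φ (fiberAffine T X U1 U0) V := by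
    intro p hp
    rw [heq p hp, hU1' p.1 ⟨p, hp, rfl⟩]
    rfl
  refine ⟨T, X, U1, U0, ⟨hT, hX, hU1, hU0, fun p hp => ?_⟩, heq'⟩
  have hpt : p.1.1 ∈ (fun p : Total => p.1.1) '' V := ⟨p, hp, rfl⟩
  have hpb : p.1 ∈ Prod.fst '' V := ⟨p, hp, rfl⟩
  have dX := (hX.contDiffAt (hbase.mem_nhds hpb)).differentiableAt (by simp)
  obtain ⟨-, hd⟩ := differentiableAt_and_fderiv_fiberAffine
    ((hT.contDiffAt (htime.mem_nhds hpt)).differentiableAt (by simp)) dX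
    ((hU1.contDiffAt (htime.mem_nhds hpt)).differentiableAt (by simp))
    ((hU0.contDiffAt (hbase.mem_nhds hpb)).differentiableAt (by simp))
  have hfd : fderiv ℝ φ p = fderiv ℝ (fiberAffine T X U1 U0) p :=
    (heq'.eventuallyEq_of_mem (hV.mem_nhds hp)).fderiv_eq
  have n1 := h.T_ne_zero hr hp
  have n2 := h.X_x_ne_zero hr hp
  have n3 := h.U_u_ne_zero hr hp
  rw [hfd, hd] at n1 n2 n3
  rw [(hasDerivAt_snd_slice dX).deriv]
  exact mul_ne_zero (mul_ne_zero (by simpa using n1) (by simpa using n2)) (by simpa using n3)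

/-! ### Higher-order chain rule in `x`. -/

/-- The partial derivative in `x`, as an operator on functions. -/
noncomputable def partialX (F : Base → ℝ) : Base → ℝ := fun b => fderiv ℝ F b (0, 1)

/-- The partial derivative in `t`, as an operator on functions. -/
noncomputable def partialT (F : Base → ℝ) : Base → ℝ := fun b => fderiv ℝ F b (1, 0)

/-- The coefficients of the chain rule `∂ₓᵏ (h ∘ X) = ∑ⱼ bell X k j · (h⁽ʲ⁾ ∘ X)`. -/
noncomputable def bell (X : Base → ℝ) : ℕ → ℕ → Base → ℝ
  | 0, j => fun _ => if j = 0 then 1 else 0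
  | k + 1, 0 => partialX (bell X k 0)
  | k + 1, j + 1 => fun b => partialX (bell X k (j + 1)) b + partialX X b * bell X k j b

section bell
variable {Ω : Set Base} {X F : Base → ℝ}

theorem contDiffOn_partialX (hΩ : IsOpen Ω) (hF : ContDiffOn ℝ ∞ F Ω) :
    ContDiffOn ℝ ∞ (partialX F) Ω :=
  (hF.fderiv_of_isOpen hΩ (by simp)).clm_apply contDiffOn_const

theorem contDiffOn_partialT (hΩ : IsOpen Ω) (hF : ContDiffOn ℝ ∞ F Ω) :
    ContDiffOn ℝ ∞ (partialT F) Ω :=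
  (hF.fderiv_of_isOpen hΩ (by simp)).clm_apply contDiffOn_const

theorem contDiffOn_iterate_partialX (hΩ : IsOpen Ω) (hF : ContDiffOn ℝ ∞ F Ω) (k : ℕ) :
    ContDiffOn ℝ ∞ (partialX^[k] F) Ω := by
  induction k with
  | zero => exact hF
  | succ k ih =>
    rw [Function.iterate_succ_apply']
    exact contDiffOn_partialX hΩ ih

theorem contDiffOn_bell (hΩ : IsOpen Ω) (hX : ContDiffOn ℝ ∞ X Ω) (k j : ℕ) :
    ContDiffOn ℝ ∞ (bell X k j) Ω := by
  induction k generalizing j with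
  | zero => exact contDiffOn_const
  | succ k ih =>
    cases j with
    | zero => exact contDiffOn_partialX hΩ (ih 0)
    | succ j =>
      exact (contDiffOn_partialX hΩ (ih _)).add ((contDiffOn_partialX hΩ hX).mul (ih j))

theorem partialX_zero : partialX (fun _ => 0) = fun _ => 0 := by
  ext b; simp [partialX]

theorem bell_eq_zero {k j : ℕ} (h : k < j) : bell X k j = fun _ => 0 := by
  induction k generalizing j with
  | zero => ext b; simp [bell, h.ne']
  | succ k ih =>
    obtain ⟨j, rfl⟩ := Nat.exists_eq_succ_of_ne_zero (Nat.ne_zero_of_lt h)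
    ext b
    simp only [bell]
    rw [ih (by omega), ih (by omega), partialX_zero]
    simp

theorem bell_self (k : ℕ) (b : Base) : bell X k k b = partialX X b ^ k := by
  induction k with
  | zero => simp [bell]
  | succ k ih =>
    simp only [bell]
    rw [bell_eq_zero (Nat.lt_succ_self k), partialX_zero, ih]
    ring

theorem hasDerivAt_slice_partialX (hΩ : IsOpen Ω) (hF : ContDiffOn ℝ ∞ F Ω) {b : Base}
    (hb : b ∈ Ω) : HasDerivAt (fun y => F (b.1, y)) (partialX F b) b.2 :=
  hasDerivAt_snd_slice ((hF.contDiffAt (hΩ.mem_nhds hb)).differentiableAt (by simp))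

theorem eventually_slice_mem (hΩ : IsOpen Ω) {b : Base} (hb : b ∈ Ω) :
    ∀ᶠ y in 𝓝 b.2, (b.1, y) ∈ Ω := by
  have : ContinuousAt (fun s : ℝ => ((b.1, s) : Base)) b.2 := by fun_prop
  exact this.eventually (hΩ.mem_nhds hb)

theorem dx_eq_iterate_partialX (hΩ : IsOpen Ω) (hF : ContDiffOn ℝ ∞ F Ω) (k : ℕ) :
    ∀ b ∈ Ω, dx k F b = partialX^[k] F b := by
  induction k with
  | zero => intro b _; simp [dx]
  | succ k ih =>
    intro b hb
    have h1 : iteratedDeriv k (fun y => F (b.1, y)) =ᶠ[𝓝 b.2]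
        fun y => partialX^[k] F (b.1, y) := by
      filter_upwards [eventually_slice_mem hΩ hb] with y hy using ih _ hy
    rw [dx, iteratedDeriv_succ, h1.deriv_eq, Function.iterate_succ_apply']
    exact (hasDerivAt_slice_partialX hΩ (contDiffOn_iterate_partialX hΩ hF k) hb).deriv

theorem dx_comp (hΩ : IsOpen Ω) (hX : ContDiffOn ℝ ∞ X Ω) {h : ℝ → ℝ} (hh : ContDiff ℝ ∞ h)
    (k : ℕ) : ∀ b ∈ Ω, dx k (fun a => h (X a)) b
      = ∑ j ∈ Finset.range (k + 1), bell X k j b * iteratedDeriv j h (X b) := by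
  induction k with
  | zero => intro b _; simp [dx, bell]
  | succ k ih =>
    intro b hb
    have h1 : iteratedDeriv k (fun y => h (X (b.1, y))) =ᶠ[𝓝 b.2]
        fun y => ∑ j ∈ Finset.range (k + 1), bell X k j (b.1, y)
          * iteratedDeriv j h (X (b.1, y)) := by
      filter_upwards [eventually_slice_mem hΩ hb] with y hy using ih _ hy
    have h2 : ∀ j, HasDerivAt (iteratedDeriv j h) (iteratedDeriv (j + 1) h (X b)) (X b) := by
      intro j
      rw [iteratedDeriv_succ]
      exact ((hh.differentiable_iteratedDeriv j (by exact_mod_cast ENat.natCast_lt_top j)) _).hasDerivAt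
    have h3 := HasDerivAt.fun_sum (u := Finset.range (k + 1)) fun j _ =>
      (hasDerivAt_slice_partialX hΩ (contDiffOn_bell hΩ hX k j) hb).mul
        ((h2 j).comp b.2 (hasDerivAt_slice_partialX hΩ hX hb))
    rw [dx, iteratedDeriv_succ, h1.deriv_eq]
    refine h3.deriv.trans ?_
    -- The range may be extended by one because `bell X k (k + 1)` is identically zero; both sums of
    -- the recursion then match.
    have h4 : ∑ j ∈ Finset.range (k + 1), partialX (bell X k j) b * iteratedDeriv j h (X b)
        = ∑ j ∈ Finset.range (k + 2), partialX (bell X k j) b * iteratedDeriv j h (X b) := by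
      rw [Finset.sum_range_succ _ (k + 1), bell_eq_zero (Nat.lt_succ_self k), partialX_zero]
      simp
    rw [Finset.sum_range_succ' _ (k + 1), Finset.sum_add_distrib]
    simp only [bell, add_mul, Finset.sum_add_distrib]
    simp only [Function.comp]
    rw [h4, Finset.sum_range_succ' _ (k + 1), add_right_comm]
    congr 2
    exact Finset.sum_congr rfl fun j _ => by ring

theorem dx_comp_fin (hΩ : IsOpen Ω) (hX : ContDiffOn ℝ ∞ X Ω) {g : Base → ℝ}
    (hg : ContDiff ℝ ∞ g) {T : ℝ → ℝ} {r k : ℕ} (hk : k ≤ r) {b : Base} (hb : b ∈ Ω) :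
    dx k (fun a => g (T a.1, X a)) b
      = ∑ j : Fin (r + 1), bell X k j b * dx j g (T b.1, X b) := by
  have h1 : dx k (fun a => g (T a.1, X a)) b = dx k (fun a => g (T b.1, X a)) b := rfl
  rw [h1, dx_comp hΩ hX (contDiff_snd_slice hg (T b.1)) k b hb,
    Fin.sum_univ_eq_sum_range (fun j => bell X k j b * dx j g (T b.1, X b))]
  refine Finset.sum_subset (Finset.range_mono (by omega)) fun j _ hj => ?_
  rw [bell_eq_zero (by simpa using hj), zero_mul]

end bell

/-! ### The induced action on the arbitrary elements. -/

/-- The transformation of the arbitrary elements, over the point `b = (t, x)`, that accompanies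
the map `fiberAffine T X U1 U0`. -/
noncomputable def pushCoeffs {r : ℕ} (T : ℝ → ℝ) (X : Base → ℝ) (U1 : ℝ → ℝ) (U0 : Base → ℝ)
    (b : Base) (c : Coeffs r) : Coeffs r :=
  (fun j => (∑ k : Fin (r + 1), c.A k * bell X k j b
      + (if (j : ℕ) = 0 then (deriv U1 b.1 + c.C * partialX U0 b) / U1 b.1 else 0)
      + (if (j : ℕ) = 1 then c.C * U0 b * partialX X b / U1 b.1 - partialT X b else 0))
        / deriv T b.1,
    (U1 b.1 * c.B - ∑ k : Fin (r + 1), c.A k * partialX^[k] U0 b + partialT U0 b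
      - U0 b * (deriv U1 b.1 + c.C * partialX U0 b) / U1 b.1) / deriv T b.1,
    c.C * partialX X b / (U1 b.1 * deriv T b.1))

theorem sum_ite_val_eq {r m : ℕ} (hm : m ≤ r) (a : ℝ) (g : ℕ → ℝ) :
    ∑ j : Fin (r + 1), (if (j : ℕ) = m then a else 0) * g j = a * g m := by
  rw [Finset.sum_eq_single ⟨m, Nat.lt_succ_of_le hm⟩]
  · simp
  · intro j _ hj
    rw [if_neg fun h => hj (Fin.ext h), zero_mul]
  · simp

/-- The coefficient formula comes from differentiating `U1 * f + U0 = g ∘ (T, X)` in `x` (`eX`) and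
in `t` (`eT`), substituting into the old equation and collecting derivatives of `g`. Both nonzero
factors `T_t` and `U1` are kept, so either residual vanishes exactly when the other does. -/
theorem linearPart_pushCoeffs {Ω : Set Base} {T : ℝ → ℝ} {X : Base → ℝ} {U1 : ℝ → ℝ}
    {U0 : Base → ℝ} {r : ℕ} (hr : 2 ≤ r) (hΩ : IsOpen Ω) (hX : ContDiffOn ℝ ∞ X Ω)
    (hU0 : ContDiffOn ℝ ∞ U0 Ω) {b : Base} (hb : b ∈ Ω) (hT : DifferentiableAt ℝ T b.1)
    (hU1 : DifferentiableAt ℝ U1 b.1) (hT' : deriv T b.1 ≠ 0) (hU1' : U1 b.1 ≠ 0)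
    {f g : Base → ℝ} (hf : ContDiff ℝ ∞ f) (hg : ContDiff ℝ ∞ g)
    (he : ∀ᶠ a in 𝓝 b, U1 a.1 * f a + U0 a = g (T a.1, X a)) (c : Coeffs r) :
    deriv T b.1 * (linearPart (pushCoeffs T X U1 U0 b c) (g (T b.1, X b)) g (T b.1, X b)
        - (pushCoeffs T X U1 U0 b c).B)
      = U1 b.1 * (linearPart c (f b) f b - c.B) := by
  have e0 := he.self_of_nhds
  have eX : ∀ k ≤ r, U1 b.1 * dx k f b + partialX^[k] U0 b
      = ∑ j : Fin (r + 1), bell X k j b * dx j g (T b.1, X b) := by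
    intro k hk
    rw [← dx_comp_fin hΩ hX hg hk hb, ← dx_eq_iterate_partialX hΩ hU0 k b hb]
    have h1 : (fun y => U1 b.1 * f (b.1, y) + U0 (b.1, y)) =ᶠ[𝓝 b.2]
        fun y => g (T b.1, X (b.1, y)) := by
      have : ContinuousAt (fun s : ℝ => ((b.1, s) : Base)) b.2 := by fun_prop
      exact this.eventually he
    have h2 : ContDiffAt ℝ ∞ (fun y => U0 (b.1, y)) b.2 :=
      (hU0.contDiffAt (hΩ.mem_nhds hb)).comp b.2 (by fun_prop)
    have h3 := contDiff_snd_slice hf b.1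
    have h4 := h1.iteratedDeriv_eq k
    rw [iteratedDeriv_fun_add
      ((contDiff_const.mul h3).contDiffAt.of_le (by exact_mod_cast le_top))
      (h2.of_le (by exact_mod_cast le_top)), iteratedDeriv_const_mul_field] at h4
    exact h4
  have eT : deriv U1 b.1 * f b + U1 b.1 * dt f b + partialT U0 b
      = dt g (T b.1, X b) * deriv T b.1 + dx 1 g (T b.1, X b) * partialT X b := by
    have h1 : (fun s => U1 s * f (s, b.2) + U0 (s, b.2)) =ᶠ[𝓝 b.1]
        fun s => g (T s, X (s, b.2)) := by
      have : ContinuousAt (fun s : ℝ => ((s, b.2) : Base)) b.1 := by fun_prop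
      exact this.eventually he
    have h2 := (hU1.hasDerivAt.mul ((contDiff_fst_slice hf b.2).differentiable
      (by simp) b.1).hasDerivAt).add (hasDerivAt_fst_slice
        ((hU0.contDiffAt (hΩ.mem_nhds hb)).differentiableAt (by simp)))
    have h3 := hT.hasDerivAt.prodMk (hasDerivAt_fst_slice
      ((hX.contDiffAt (hΩ.mem_nhds hb)).differentiableAt (by simp)))
    have h4 : HasFDerivAt g (fderiv ℝ g (T b.1, X b)) (T b.1, X b) :=
      (hg.differentiable (by simp) _).hasFDerivAt
    have h5 := HasDerivAt.unique (h2.congr_of_eventuallyEq h1.symm) (h4.comp_hasDerivAt b.1 h3)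
    rw [fderiv_apply_eq hg] at h5
    simp only [partialT, dt] at h5 ⊢
    linear_combination h5
  have e1 : U1 b.1 * dx 1 f b + partialX U0 b = partialX X b * dx 1 g (T b.1, X b) := by
    have h1 := eX 1 (by omega)
    have h2 : ∀ j : Fin (r + 1), bell X 1 j b
        = if (j : ℕ) = 1 then partialX X b else 0 := by
      intro j
      split_ifs with hj
      · rw [hj, bell_self, pow_one]
      · rcases Nat.lt_or_ge 1 j with h | h
        · rw [bell_eq_zero h]
        · have : (j : ℕ) = 0 := by omega
          rw [this]
          simp [bell, partialX]
    simp only [h2, sum_ite_val_eq (show 1 ≤ r by omega)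
      (g := fun j => dx j g (T b.1, X b)), Function.iterate_one] at h1
    exact h1
  have eS : U1 b.1 * ∑ k : Fin (r + 1), c.A k * dx k f b
      + ∑ k : Fin (r + 1), c.A k * partialX^[k] U0 b
      = ∑ j : Fin (r + 1), (∑ k : Fin (r + 1), c.A k * bell X k j b)
        * dx j g (T b.1, X b) := by
    simp only [Finset.sum_mul]
    rw [Finset.sum_comm, Finset.mul_sum, ← Finset.sum_add_distrib]
    refine Finset.sum_congr rfl fun k _ => ?_
    have := eX k (Nat.lt_succ_iff.1 k.2)
    simp only [mul_assoc, ← Finset.mul_sum]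
    rw [← this]
    ring
  have eA : deriv T b.1 * ∑ j : Fin (r + 1), (pushCoeffs T X U1 U0 b c).A j
        * dx j g (T b.1, X b)
      = ∑ j : Fin (r + 1), (∑ k : Fin (r + 1), c.A k * bell X k j b) * dx j g (T b.1, X b)
        + (deriv U1 b.1 + c.C * partialX U0 b) / U1 b.1 * dx 0 g (T b.1, X b)
        + (c.C * U0 b * partialX X b / U1 b.1 - partialT X b) * dx 1 g (T b.1, X b) := by
    rw [← sum_ite_val_eq (Nat.zero_le r) _ fun j => dx j g (T b.1, X b),
      ← sum_ite_val_eq (show 1 ≤ r by omega) _ fun j => dx j g (T b.1, X b),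
      ← Finset.sum_add_distrib, ← Finset.sum_add_distrib, Finset.mul_sum]
    refine Finset.sum_congr rfl fun j _ => ?_
    simp only [pushCoeffs, Coeffs.A]
    field_simp
  have eB : deriv T b.1 * (pushCoeffs T X U1 U0 b c).B
      = U1 b.1 * c.B - ∑ k : Fin (r + 1), c.A k * partialX^[k] U0 b + partialT U0 b
      - U0 b * (deriv U1 b.1 + c.C * partialX U0 b) / U1 b.1 := by
    simp only [pushCoeffs]
    rw [Coeffs.B, mul_div_cancel₀ _ hT']
  have eC : deriv T b.1 * (pushCoeffs T X U1 U0 b c).C = c.C * partialX X b / U1 b.1 := by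
    simp only [pushCoeffs]
    rw [Coeffs.C]
    field_simp
  have g0 : dx 0 g (T b.1, X b) = U1 b.1 * f b + U0 b := by rw [e0]; simp [dx]
  have expand : deriv T b.1 * (linearPart (pushCoeffs T X U1 U0 b c) (g (T b.1, X b)) g
        (T b.1, X b) - (pushCoeffs T X U1 U0 b c).B)
      = dt g (T b.1, X b) * deriv T b.1
        + (deriv T b.1 * (pushCoeffs T X U1 U0 b c).C) * g (T b.1, X b) * dx 1 g (T b.1, X b)
        - deriv T b.1 * ∑ j : Fin (r + 1), (pushCoeffs T X U1 U0 b c).A j * dx j g (T b.1, X b)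
        - deriv T b.1 * (pushCoeffs T X U1 U0 b c).B := by
    simp only [linearPart]; ring
  rw [expand, eA, eB, eC, ← eS, g0, ← e0, linearPart]
  generalize dt g (T b.1, X b) = gt at *
  generalize dx 1 g (T b.1, X b) = g1 at *
  generalize ∑ k : Fin (r + 1), c.A k * dx k f b = SA at *
  generalize ∑ k : Fin (r + 1), c.A k * partialX^[k] U0 b = SU at *
  field_simp
  linear_combination (-U1 b.1) * eT - c.C * U1 b.1 * f b * e1

/-! ### Fibre-affine maps and `pushCoeffs` as point transformations. -/

section parameters
variable {r : ℕ} {V : Set Total} {T : ℝ → ℝ} {X : Base → ℝ} {U1 : ℝ → ℝ} {U0 : Base → ℝ}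

theorem AreParameters.differentiableAt (hV : IsOpen V) (hP : AreParameters V T X U1 U0) {b : Base}
    (hb : b ∈ Prod.fst '' V) : DifferentiableAt ℝ T b.1 ∧ DifferentiableAt ℝ X b ∧
      DifferentiableAt ℝ U1 b.1 ∧ DifferentiableAt ℝ U0 b := by
  obtain ⟨hT, hX, hU1, hU0, -⟩ := hP
  have ht : b.1 ∈ (fun p : Total => p.1.1) '' V := by
    obtain ⟨p, hp, rfl⟩ := hb
    exact ⟨p, hp, rfl⟩
  exact ⟨(hT.contDiffAt ((isOpen_time hV).mem_nhds ht)).differentiableAt (by simp),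
    (hX.contDiffAt ((isOpen_base hV).mem_nhds hb)).differentiableAt (by simp),
    (hU1.contDiffAt ((isOpen_time hV).mem_nhds ht)).differentiableAt (by simp),
    (hU0.contDiffAt ((isOpen_base hV).mem_nhds hb)).differentiableAt (by simp)⟩

theorem AreParameters.ne_zero (hV : IsOpen V) (hP : AreParameters V T X U1 U0) {b : Base}
    (hb : b ∈ Prod.fst '' V) : deriv T b.1 ≠ 0 ∧ partialX X b ≠ 0 ∧ U1 b.1 ≠ 0 := by
  have hd := (hP.differentiableAt hV hb).2.1
  obtain ⟨p, hp, rfl⟩ := hb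
  have h := hP.2.2.2.2 p hp
  rw [(hasDerivAt_snd_slice hd).deriv] at h
  exact ⟨left_ne_zero_of_mul (left_ne_zero_of_mul h), right_ne_zero_of_mul (left_ne_zero_of_mul h),
    right_ne_zero_of_mul h⟩

/-- Mean value theorem on segments of the convex base: equal `T` forces equal `t`; the remaining
segment is then parallel to the `x`-axis, where `X_x ≠ 0`. -/
theorem AreParameters.injOn_base (hV : IsOpen V) (hc : Convex ℝ V)
    (hP : AreParameters V T X U1 U0) :
    InjOn (fun b : Base => ((T b.1, X b) : Base)) (Prod.fst '' V) := by
  have hcb : Convex ℝ (Prod.fst '' V) := hc.linear_image (LinearMap.fst ℝ Base ℝ)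
  -- a function with nonvanishing derivative along a segment takes different values at its ends
  have aux : ∀ (F : Base → ℝ), (∀ b ∈ Prod.fst '' V, DifferentiableAt ℝ F b) →
      ∀ a ∈ Prod.fst '' V, ∀ b ∈ Prod.fst '' V, F a = F b →
        ∃ z ∈ Prod.fst '' V, fderiv ℝ F z (b - a) = 0 := by
    intro F hF a ha b hb hab
    obtain ⟨z, hz, he⟩ := domain_mvt (f' := fderiv ℝ F)
      (fun z hz => (hF z hz).hasFDerivAt.hasFDerivWithinAt) hcb ha hb
    exact ⟨z, hcb.segment_subset ha hb hz, by rw [← he, hab, sub_self]⟩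
  intro a ha b hb hab
  have hT : T a.1 = T b.1 := congrArg Prod.fst hab
  have hX : X a = X b := congrArg Prod.snd hab
  have hdT : ∀ b ∈ Prod.fst '' V, HasFDerivAt (fun b : Base => T b.1) _ b := fun b hb =>
    (hP.differentiableAt hV hb).1.hasDerivAt.comp_hasFDerivAt b (hasFDerivAt_id (𝕜 := ℝ) b).fst
  obtain ⟨z, hz, hz0⟩ := aux (fun b => T b.1) (fun b hb => (hdT b hb).differentiableAt) a ha b hb hT
  have h1 : b.1 - a.1 = 0 := by
    rw [(hdT z hz).fderiv] at hz0
    have h2 : deriv T z.1 * (b.1 - a.1) = 0 := by simpa using hz0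
    exact (mul_eq_zero.1 h2).resolve_left (hP.ne_zero hV hz).1
  obtain ⟨w, hw, hw0⟩ := aux X (fun b hb => (hP.differentiableAt hV hb).2.1) a ha b hb hX
  have h2 : b - a = (b.2 - a.2) • (0, 1) := by ext <;> simp [h1]
  rw [h2, map_smul] at hw0
  have h3 := (mul_eq_zero.1 hw0).resolve_right (hP.ne_zero hV hw).2.1
  exact Prod.ext (by linarith) (by linarith)

theorem AreParameters.contDiffOn_fst (hP : AreParameters V T X U1 U0) :
    ContDiffOn ℝ ∞ (fun b : Base => T b.1) (Prod.fst '' V) ∧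
      ContDiffOn ℝ ∞ (fun b : Base => U1 b.1) (Prod.fst '' V) := by
  have hm : MapsTo (fun b : Base => b.1) (Prod.fst '' V) ((fun p : Total => p.1.1) '' V) := by
    rintro _ ⟨p, hp, rfl⟩
    exact ⟨p, hp, rfl⟩
  exact ⟨hP.1.comp contDiff_fst.contDiffOn hm, hP.2.2.1.comp contDiff_fst.contDiffOn hm⟩

theorem AreParameters.contDiffOn_deriv (hV : IsOpen V) (hP : AreParameters V T X U1 U0) :
    ContDiffOn ℝ ∞ (fun b : Base => deriv T b.1) (Prod.fst '' V) ∧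
      ContDiffOn ℝ ∞ (fun b : Base => deriv U1 b.1) (Prod.fst '' V) := by
  have hm : MapsTo (fun b : Base => b.1) (Prod.fst '' V) ((fun p : Total => p.1.1) '' V) := by
    rintro _ ⟨p, hp, rfl⟩
    exact ⟨p, hp, rfl⟩
  exact ⟨(hP.1.deriv_of_isOpen (isOpen_time hV) (by simp)).comp contDiff_fst.contDiffOn hm,
    (hP.2.2.1.deriv_of_isOpen (isOpen_time hV) (by simp)).comp contDiff_fst.contDiffOn hm⟩

theorem AreParameters.isPointTransformation (hV : IsOpen V) (hc : Convex ℝ V)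
    (hP : AreParameters V T X U1 U0) {φ : Total → Total}
    (hφ : EqOn φ (fiberAffine T X U1 U0) V) : IsPointTransformation V φ := by
  have hm : MapsTo (Prod.fst : Total → Base) V (Prod.fst '' V) := mapsTo_image _ _
  have hfst : ContDiffOn ℝ ∞ (Prod.fst : Total → Base) V := contDiff_fst.contDiffOn
  refine ⟨hV, ContDiffOn.congr ?_ hφ, ?_, fun p hp => ?_⟩
  · exact ((hP.contDiffOn_fst.1.comp hfst hm).prodMk (hP.2.1.comp hfst hm)).prodMk
      (((hP.contDiffOn_fst.2.comp hfst hm).mul contDiff_snd.contDiffOn).add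
        (hP.2.2.2.1.comp hfst hm))
  · intro p hp p' hp' he
    rw [hφ hp, hφ hp'] at he
    have h1 : p.1 = p'.1 := hP.injOn_base hV hc (hm hp) (hm hp') (congrArg Prod.fst he)
    have h2 : U1 p.1.1 * p.2 + U0 p.1 = U1 p'.1.1 * p'.2 + U0 p'.1 := congrArg Prod.snd he
    rw [← h1, add_left_inj] at h2
    exact Prod.ext h1 (mul_left_cancel₀ (hP.ne_zero hV (hm hp)).2.2 h2)
  · obtain ⟨d1, d2, d3, d4⟩ := hP.differentiableAt hV (hm hp)
    obtain ⟨n1, n2, n3⟩ := hP.ne_zero hV (hm hp)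
    obtain ⟨-, hd⟩ := differentiableAt_and_fderiv_fiberAffine d1 d2 d3 d4
    rw [(hφ.eventuallyEq_of_mem (hV.mem_nhds hp)).fderiv_eq]
    refine isInvertible_of_injective fun v hv => ?_
    rw [hd] at hv
    simp only [Prod.mk_eq_zero] at hv
    obtain ⟨⟨h1, h2⟩, h3⟩ := hv
    have e1 : v.1.1 = 0 := (mul_eq_zero.1 h1).resolve_left n1
    have e2 : v.1 = v.1.2 • (0, 1) := by ext <;> simp [e1]
    rw [e2, map_smul] at h2
    have e3 : v.1.2 = 0 := (mul_eq_zero.1 h2).resolve_right n2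
    have e4 : v.1 = 0 := Prod.ext e1 e3
    rw [e4, map_zero] at h3
    have e5 : U1 p.1.1 * v.2 = 0 := by simpa using h3
    exact Prod.ext e4 ((mul_eq_zero.1 e5).resolve_left n3)

theorem AreParameters.exists_base_localInverse (hV : IsOpen V) (hP : AreParameters V T X U1 U0)
    {b : Base} (hb : b ∈ Prod.fst '' V) :
    ∃ (N : Set Base) (χ : Base → Base), IsOpen N ∧ ((T b.1, X b) : Base) ∈ N ∧
      ContDiffOn ℝ ∞ χ N ∧
      (∀ q ∈ N, χ q ∈ Prod.fst '' V ∧ ((T (χ q).1, X (χ q)) : Base) = q) ∧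
      ∀ᶠ a in 𝓝 b, χ (T a.1, X a) = a := by
  obtain ⟨d1, d2, -, -⟩ := hP.differentiableAt hV hb
  obtain ⟨n1, n2, -⟩ := hP.ne_zero hV hb
  have hd := (d1.hasDerivAt.comp_hasFDerivAt b (hasFDerivAt_id (𝕜 := ℝ) b).fst).prodMk
    d2.hasFDerivAt
  refine exists_contDiffOn_localInverse (ψ := fun b : Base => ((T b.1, X b) : Base))
    (isOpen_base hV) hb (hP.contDiffOn_fst.1.prodMk hP.2.1) ?_
  have hd' : fderiv ℝ (fun b : Base => ((T b.1, X b) : Base)) b = _ := hd.fderiv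
  rw [hd']
  refine isInvertible_of_injective fun v hv => ?_
  have h1 : deriv T b.1 * v.1 = 0 := by simpa using congrArg Prod.fst hv
  have h2 : fderiv ℝ X b v = 0 := congrArg Prod.snd hv
  have e1 : v.1 = 0 := (mul_eq_zero.1 h1).resolve_left n1
  have e2 : v = v.2 • (0, 1) := by ext <;> simp [e1]
  rw [e2, map_smul] at h2
  exact Prod.ext e1 ((mul_eq_zero.1 h2).resolve_right n2)

theorem AreParameters.contDiffOn_pushCoeffs (hV : IsOpen V) (hP : AreParameters V T X U1 U0) :
    ContDiffOn ℝ ∞ (fun z : Base × Coeffs r => pushCoeffs T X U1 U0 z.1 z.2)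
      ((Prod.fst '' V) ×ˢ univ) := by
  have hΩ := isOpen_base hV
  have hf : ContDiffOn ℝ ∞ (Prod.fst : Base × Coeffs r → Base) ((Prod.fst '' V) ×ˢ univ) :=
    contDiff_fst.contDiffOn
  have lift : ∀ {F : Base → ℝ}, ContDiffOn ℝ ∞ F (Prod.fst '' V) →
      ContDiffOn ℝ ∞ (fun z : Base × Coeffs r => F z.1) ((Prod.fst '' V) ×ˢ univ) :=
    fun hF => hF.comp hf fun z hz => hz.1
  have hA : ∀ k, ContDiffOn ℝ ∞ (fun z : Base × Coeffs r => z.2.A k)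
      ((Prod.fst '' V) ×ˢ univ) := fun k => by
    unfold Coeffs.A; exact ContDiff.contDiffOn (by fun_prop)
  have hB : ContDiffOn ℝ ∞ (fun z : Base × Coeffs r => z.2.B) ((Prod.fst '' V) ×ˢ univ) := by
    unfold Coeffs.B; exact ContDiff.contDiffOn (by fun_prop)
  have hC : ContDiffOn ℝ ∞ (fun z : Base × Coeffs r => z.2.C) ((Prod.fst '' V) ×ˢ univ) := by
    unfold Coeffs.C; exact ContDiff.contDiffOn (by fun_prop)
  have n := fun (z : Base × Coeffs r) (hz : z ∈ (Prod.fst '' V) ×ˢ univ) => hP.ne_zero hV hz.1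
  have hT1 := lift (hP.contDiffOn_deriv hV).1
  have hU1 := lift hP.contDiffOn_fst.2
  have hU11 := lift (hP.contDiffOn_deriv hV).2
  have hU0 := lift hP.2.2.2.1
  have hU0x := lift (contDiffOn_partialX hΩ hP.2.2.2.1)
  have hXx := lift (contDiffOn_partialX hΩ hP.2.1)
  refine ContDiffOn.prodMk (contDiffOn_pi.2 fun j => ContDiffOn.div ?_ hT1 fun z hz => (n z hz).1)
    (ContDiffOn.prodMk (ContDiffOn.div ?_ hT1 fun z hz => (n z hz).1)
      ((hC.mul hXx).div (hU1.mul hT1) fun z hz => mul_ne_zero (n z hz).2.2 (n z hz).1))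
  · refine ((ContDiffOn.sum fun k _ => (hA k).mul (lift (contDiffOn_bell hΩ hP.2.1 k j))).add
      ?_).add ?_
    · split_ifs
      · exact (hU11.add (hC.mul hU0x)).div hU1 fun z hz => (n z hz).2.2
      · exact contDiffOn_const
    · split_ifs
      · exact (((hC.mul hU0).mul hXx).div hU1 fun z hz => (n z hz).2.2).sub
          (lift (contDiffOn_partialT hΩ hP.2.1))
      · exact contDiffOn_const
  · exact (((hU1.mul hB).sub (ContDiffOn.sum fun (k : Fin (r + 1)) _ =>
      (hA k).mul (lift (contDiffOn_iterate_partialX hΩ hP.2.2.2.1 k)))).add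
      (lift (contDiffOn_partialT hΩ hP.2.2.2.1))).sub
      ((hU0.mul (hU11.add (hC.mul hU0x))).div hU1 fun z hz => (n z hz).2.2)

/-- The action is triangular: `C` is recovered first, then the `Aᵏ` through the triangular matrix of
`bell` with diagonal `X_x ^ k`, and finally `B`. -/
theorem pushCoeffs_injective {b : Base} (hT : deriv T b.1 ≠ 0) (hX : partialX X b ≠ 0)
    (hU1 : U1 b.1 ≠ 0) : Function.Injective (pushCoeffs (r := r) T X U1 U0 b) := by
  intro c c' h
  have hC : c.C = c'.C := by
    have h1 : c.C * partialX X b / (U1 b.1 * deriv T b.1)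
        = c'.C * partialX X b / (U1 b.1 * deriv T b.1) := congrArg (fun c => c.2.2) h
    rw [div_left_inj' (mul_ne_zero hU1 hT)] at h1
    exact mul_right_cancel₀ hX h1
  let M : Matrix (Fin (r + 1)) (Fin (r + 1)) ℝ := fun j k => bell X k j b
  have hM : M.det ≠ 0 := by
    rw [Matrix.det_of_isUpperTriangular]
    · refine Finset.prod_ne_zero_iff.2 fun j _ => ?_
      change bell X j j b ≠ 0
      rw [bell_self]
      exact pow_ne_zero _ hX
    · intro j k hjk
      change bell X k j b = 0
      rw [bell_eq_zero (show (k : ℕ) < j from hjk)]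
  have hA : ∀ k, c.A k = c'.A k := by
    have h2 : M.mulVec (fun k => c.A k - c'.A k) = 0 := by
      ext j
      have h1 : (pushCoeffs T X U1 U0 b c).1 j = (pushCoeffs T X U1 U0 b c').1 j := by rw [h]
      simp only [pushCoeffs] at h1
      rw [div_left_inj' hT, hC, add_left_inj, add_left_inj] at h1
      rw [Matrix.mulVec, dotProduct]
      simp only [M, mul_comm (bell X _ _ b), sub_mul, Finset.sum_sub_distrib, Pi.zero_apply]
      rw [h1, sub_self]
    have h3 := Matrix.eq_zero_of_mulVec_eq_zero hM h2
    intro k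
    exact sub_eq_zero.1 (congrFun h3 k)
  have hB : c.B = c'.B := by
    have h1 : (pushCoeffs T X U1 U0 b c).2.1 = (pushCoeffs T X U1 U0 b c').2.1 := by rw [h]
    simp only [pushCoeffs] at h1
    rw [div_left_inj' hT, hC] at h1
    simp only [hA, sub_left_inj, add_left_inj] at h1
    exact mul_left_cancel₀ hU1 h1
  exact Prod.ext (funext hA) (Prod.ext hB hC)

/-- Expresses that `pushCoeffs` is affine in the coefficients; its directional derivatives are
therefore finite differences, and injectivity passes to the differential. -/
theorem pushCoeffs_line (b : Base) (c w : Coeffs r) (s : ℝ) :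
    pushCoeffs T X U1 U0 b (c + s • w) = pushCoeffs T X U1 U0 b c
      + s • (pushCoeffs T X U1 U0 b (c + w) - pushCoeffs T X U1 U0 b c) := by
  have hs : ∀ β : Fin (r + 1) → ℝ, ∀ s : ℝ, ∑ k, (c.1 k + s * w.1 k) * β k
      = ∑ k, c.1 k * β k + s * ∑ k, w.1 k * β k := by
    intro β s
    rw [Finset.mul_sum, ← Finset.sum_add_distrib]
    exact Finset.sum_congr rfl fun k _ => by ring
  have hs1 : ∀ β : Fin (r + 1) → ℝ, ∑ k, (c.1 k + w.1 k) * β k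
      = ∑ k, c.1 k * β k + ∑ k, w.1 k * β k := by
    intro β
    simpa using hs β 1
  ext
  · simp only [pushCoeffs, Coeffs.A, Coeffs.C, Prod.fst_add, Prod.snd_add, Prod.smul_fst,
      Prod.smul_snd, Pi.add_apply, Pi.smul_apply, smul_eq_mul, Prod.fst_sub,
      Pi.sub_apply, hs, hs1]
    split_ifs <;> ring
  · simp only [pushCoeffs, Coeffs.A, Coeffs.B, Coeffs.C, Prod.fst_add, Prod.snd_add, Prod.smul_fst,
      Prod.smul_snd, Pi.add_apply, Pi.smul_apply, smul_eq_mul, Prod.fst_sub, Prod.snd_sub,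
      hs, hs1]
    ring
  · simp only [pushCoeffs, Coeffs.C, Prod.snd_add,
      Prod.smul_snd, smul_eq_mul, Prod.snd_sub]
    ring

/-- The extra terms affect only `A⁰` and `A¹`, so for `r ≥ 2` the leading coefficient is just
multiplied by `X_x ^ r / T_t`. -/
theorem pushCoeffs_mem_regular (hr : 2 ≤ r) {b : Base} (hT : deriv T b.1 ≠ 0)
    (hX : partialX X b ≠ 0) (hU1 : U1 b.1 ≠ 0) {c : Coeffs r} (hc : c ∈ regular r) :
    pushCoeffs T X U1 U0 b c ∈ regular r := by
  refine mul_ne_zero (div_ne_zero (mul_ne_zero (C_ne_zero hc) hX) (mul_ne_zero hU1 hT))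
    (div_ne_zero ?_ hT)
  rw [Fin.val_last, if_neg (by omega), if_neg (by omega), add_zero, add_zero,
    Fin.sum_univ_castSucc, Finset.sum_eq_zero, zero_add, Fin.val_last, bell_self]
  · exact mul_ne_zero (A_last_ne_zero hc) (pow_ne_zero _ hX)
  · intro k _
    rw [bell_eq_zero (show ((k.castSucc : Fin (r + 1)) : ℕ) < r from k.2), mul_zero]

end parameters

theorem isOpen_regular (r : ℕ) : IsOpen (regular r) := by
  have : Continuous fun c : Coeffs r => c.C * c.A (Fin.last r) := by
    unfold Coeffs.C Coeffs.A; fun_prop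
  exact isOpen_ne.preimage this

theorem isArbitraryElement_const {r : ℕ} (Ω : Set Base) {c : Coeffs r} (hc : c ∈ regular r) :
    IsArbitraryElement r Ω fun _ => c := ⟨contDiffOn_const, fun _ _ => hc⟩

theorem IsArbitraryElement.mono {r : ℕ} {Ω Ω' : Set Base} {θ : Base → Coeffs r}
    (h : IsArbitraryElement r Ω θ) (hs : Ω' ⊆ Ω) : IsArbitraryElement r Ω' θ :=
  ⟨h.1.mono hs, fun b hb => h.2 b (hs hb)⟩

theorem IsPointTransformation.mono {E : Type*} [NormedAddCommGroup E] [NormedSpace ℝ E]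
    {W V : Set E} {φ : E → E} (h : IsPointTransformation W φ) (hV : IsOpen V) (hs : V ⊆ W) :
    IsPointTransformation V φ :=
  ⟨hV, h.2.1.mono hs, h.2.2.1.mono hs, fun p hp => h.2.2.2 p (hs hp)⟩

theorem IsAdmissible.mono {r : ℕ} {W V : Set Total} {φ : Total → Total} {θ θ' : Base → Coeffs r}
    (h : IsAdmissible r W θ θ' φ) (hV : IsOpen V) (hs : V ⊆ W) : IsAdmissible r V θ θ' φ := by
  refine ⟨h.1.mono hV hs, h.2.1.mono (image_mono hs), h.2.2.1.mono (image_mono (image_mono hs)), ?_⟩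
  rintro j j' ⟨f, g, b, hf, hg, hb, he, hj, hj'⟩
  exact h.2.2.2 j j' ⟨f, g, b, hf, hg, hs hb, he, hj, hj'⟩

/-! ### Construction of equivalence transformations and uniqueness of target coefficients. -/

section parameters
variable {r : ℕ} {V : Set Total} {T : ℝ → ℝ} {X : Base → ℝ} {U1 : ℝ → ℝ} {U0 : Base → ℝ}
  {φ : Total → Total}

theorem AreParameters.isPointTransformation_joint (hV : IsOpen V) (hc : Convex ℝ V)
    (hP : AreParameters V T X U1 U0) (hφ : EqOn φ (fiberAffine T X U1 U0) V) :
    IsPointTransformation (V ×ˢ regular r)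
      fun z : Total × Coeffs r => (φ z.1, pushCoeffs T X U1 U0 z.1.1 z.2) := by
  have hpt := hP.isPointTransformation hV hc hφ
  have hO : IsOpen (V ×ˢ regular r) := hV.prod (isOpen_regular r)
  have hpush : ContDiffOn ℝ ∞ (fun z : Total × Coeffs r => pushCoeffs T X U1 U0 z.1.1 z.2)
      (V ×ˢ regular r) := by
    have h1 : ContDiff ℝ ∞ fun z : Total × Coeffs r => ((z.1.1, z.2) : Base × Coeffs r) := by
      fun_prop
    exact (hP.contDiffOn_pushCoeffs hV).comp h1.contDiffOn
      fun z hz => ⟨mem_image_of_mem _ hz.1, mem_univ _⟩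
  have hinj : ∀ p ∈ V, Function.Injective (pushCoeffs (r := r) T X U1 U0 p.1) := fun p hp => by
    obtain ⟨n1, n2, n3⟩ := hP.ne_zero hV (mem_image_of_mem _ hp)
    exact pushCoeffs_injective n1 n2 n3
  refine ⟨hO, (hpt.2.1.comp contDiff_fst.contDiffOn fun z hz => hz.1).prodMk hpush, ?_, ?_⟩
  · rintro ⟨p, c⟩ hz ⟨p', c'⟩ hz' he
    have h1 : p = p' := hpt.2.2.1 hz.1 hz'.1 (congrArg Prod.fst he)
    subst h1
    exact Prod.ext rfl (hinj p hz.1 (congrArg Prod.snd he))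
  · rintro ⟨p, c⟩ hz
    have d1 : HasFDerivAt (fun z : Total × Coeffs r => φ z.1) _ (p, c) :=
      HasFDerivAt.comp (p, c) (hpt.hasFDerivAt hz.1) hasFDerivAt_fst
    have d2 := ((hpush.contDiffAt (hO.mem_nhds hz)).differentiableAt (by simp)).hasFDerivAt
    have d : fderiv ℝ (fun z : Total × Coeffs r => (φ z.1, pushCoeffs T X U1 U0 z.1.1 z.2)) (p, c)
      = _ := (d1.prodMk d2).fderiv
    rw [d]
    refine isInvertible_of_injective ?_
    rintro ⟨v, w⟩ hvw
    have h1 : fderiv ℝ φ p v = 0 := congrArg Prod.fst hvw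
    have h2 := congrArg Prod.snd hvw
    have hv : v = 0 := (hpt.2.2.2 p hz.1).injective (h1.trans (map_zero _).symm)
    subst hv
    have hl : HasDerivAt (fun s : ℝ => ((p, c + s • w) : Total × Coeffs r)) (0, w) 0 := by
      have := ((hasDerivAt_id (0 : ℝ)).smul_const w).const_add c
      rw [one_smul] at this
      exact (hasDerivAt_const _ _).prodMk this
    have h3 := d2.comp_hasDerivAt_of_eq (0 : ℝ) hl (by simp)
    have h4 : HasDerivAt (fun s : ℝ => pushCoeffs T X U1 U0 p.1 (c + s • w))
        (pushCoeffs T X U1 U0 p.1 (c + w) - pushCoeffs T X U1 U0 p.1 c) 0 := by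
      simp only [pushCoeffs_line]
      have := ((hasDerivAt_id (0 : ℝ)).smul_const
        (pushCoeffs T X U1 U0 p.1 (c + w) - pushCoeffs T X U1 U0 p.1 c)).const_add
        (pushCoeffs T X U1 U0 p.1 c)
      rwa [one_smul] at this
    have h5 : pushCoeffs T X U1 U0 p.1 (c + w) - pushCoeffs T X U1 U0 p.1 c = 0 :=
      (h4.unique h3).trans h2
    have h6 := hinj p hz.1 (sub_eq_zero.1 h5)
    exact Prod.ext rfl (by simpa using h6)

theorem AreParameters.isAdmissible (hr : 2 ≤ r) (hV : IsOpen V) (hc : Convex ℝ V)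
    (hP : AreParameters V T X U1 U0) (hφ : EqOn φ (fiberAffine T X U1 U0) V) {V' : Set Total}
    (hV' : IsOpen V') (hs : V' ⊆ V) {θ : Base → Coeffs r}
    (hθ : IsArbitraryElement r (Prod.fst '' V') θ) :
    ∃ θ' : Base → Coeffs r, IsAdmissible r V' θ θ' φ ∧
      ∀ p ∈ V', θ' (φ p).1 = pushCoeffs T X U1 U0 p.1 (θ p.1) := by
  have hpt := (hP.isPointTransformation hV hc hφ).mono hV' hs
  have hinj := hP.injOn_base hV hc
  -- The inverse is taken over the base of the convex set `V`; the part `V'` need not be convex.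
  let inv : Base → Base := Function.invFunOn (fun b : Base => ((T b.1, X b) : Base)) (Prod.fst '' V)
  have hinv : ∀ b ∈ Prod.fst '' V, inv (T b.1, X b) = b := fun b hb =>
    hinj.leftInvOn_invFunOn hb
  have hinvφ : ∀ p ∈ V', inv (φ p).1 = p.1 := by
    intro p hp
    rw [hφ (hs hp)]
    exact hinv _ (mem_image_of_mem _ (hs hp))
  let θ' : Base → Coeffs r := fun q => pushCoeffs T X U1 U0 (inv q) (θ (inv q))
  have hθ' : ∀ p ∈ V', θ' (φ p).1 = pushCoeffs T X U1 U0 p.1 (θ p.1) := by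
    intro p hp
    simp only [θ', hinvφ p hp]
  refine ⟨θ', ⟨hpt, hθ, ⟨?_, ?_⟩, ?_⟩, hθ'⟩
  · rintro _ ⟨_, ⟨p, hp, rfl⟩, rfl⟩
    have hpb : p.1 ∈ Prod.fst '' V := mem_image_of_mem _ (hs hp)
    have hpb' : p.1 ∈ Prod.fst '' V' := mem_image_of_mem _ hp
    obtain ⟨N, χ, hN, hbN, hχ, hχO, hχ'⟩ := hP.exists_base_localInverse hV hpb
    have hχp : χ (T p.1.1, X p.1) = p.1 := hχ'.self_of_nhds
    have e : (φ p).1 = (T p.1.1, X p.1) := by rw [hφ (hs hp)]; rfl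
    rw [e]
    have hχd := hχ.contDiffAt (hN.mem_nhds hbN)
    have hθd : ContDiffAt ℝ ∞ θ (χ (T p.1.1, X p.1)) := by
      rw [hχp]
      exact hθ.1.contDiffAt ((isOpen_base hV').mem_nhds hpb')
    have hpushd : ContDiffAt ℝ ∞ (fun z : Base × Coeffs r => pushCoeffs T X U1 U0 z.1 z.2)
        (χ (T p.1.1, X p.1), θ (χ (T p.1.1, X p.1))) := by
      rw [hχp]
      exact (hP.contDiffOn_pushCoeffs hV).contDiffAt
        (((isOpen_base hV).prod isOpen_univ).mem_nhds ⟨hpb, mem_univ _⟩)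
    have h1 : ContDiffAt ℝ ∞ (fun q => pushCoeffs T X U1 U0 (χ q) (θ (χ q))) (T p.1.1, X p.1) :=
      ContDiffAt.comp (g := fun z : Base × Coeffs r => pushCoeffs T X U1 U0 z.1 z.2)
        (f := fun q => (χ q, θ (χ q))) _ hpushd (hχd.prodMk (hθd.comp _ hχd))
    refine (h1.congr_of_eventuallyEq ?_).contDiffWithinAt
    filter_upwards [hN.mem_nhds hbN] with q hq
    have h2 : inv q = χ q := by
      obtain ⟨h3, h4⟩ := hχO q hq
      conv_lhs => rw [← h4]
      exact hinv _ h3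
    simp only [θ', h2]
  · rintro _ ⟨_, ⟨p, hp, rfl⟩, rfl⟩
    rw [hθ' p hp]
    obtain ⟨n1, n2, n3⟩ := hP.ne_zero hV (mem_image_of_mem _ (hs hp))
    exact pushCoeffs_mem_regular hr n1 n2 n3 (hθ.2 _ (mem_image_of_mem _ hp))
  · rintro j j' ⟨f, g, b, hf, hg, hb, he, rfl, rfl⟩
    have hbb : b ∈ Prod.fst '' V := ⟨_, hs hb, rfl⟩
    obtain ⟨d1, -, d3, -⟩ := hP.differentiableAt hV hbb
    obtain ⟨n1, n2, n3⟩ := hP.ne_zero hV hbb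
    have hcont : ContinuousAt (fun a => ((a, f a) : Total)) b :=
      (continuous_id.prodMk hf.continuous).continuousAt
    have he' : ∀ᶠ a in 𝓝 b, U1 a.1 * f a + U0 a = g (T a.1, X a) := by
      filter_upwards [he, hcont.eventually (hV'.mem_nhds hb)] with a h1 h2
      rwa [hφ (hs h2)] at h1
    rw [jet_mem_equation_iff (by omega), jet_mem_equation_iff (by omega), hθ' _ hb]
    have e : (φ (b, f b)).1 = (T b.1, X b) := by rw [hφ (hs hb)]; rfl
    rw [e]
    have key := linearPart_pushCoeffs hr (isOpen_base hV) hP.2.1 hP.2.2.2.1 hbb d1 d3 n1 n3 hf hg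
      he' (θ b)
    constructor
    · intro h
      rw [h, sub_self, mul_zero] at key
      exact sub_eq_zero.1 ((mul_eq_zero.1 key).resolve_left n1)
    · intro h
      rw [h, sub_self, mul_zero] at key
      exact sub_eq_zero.1 ((mul_eq_zero.1 key.symm).resolve_left n3)

/-- The equation determines `u_t` as a function of the other jet coordinates, so equal solution jets
give equal right-hand sides. Varying `u_k` reads off the coefficients; two values of `u` are needed
to separate `A⁰` from `B` and `C` from `A¹`. -/
theorem coeffs_eq_of_linearPart_iff (hr : 2 ≤ r) {c c' : Coeffs r} {q : Base} {u v : ℝ} (huv : u ≠ v)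
    (h : ∀ g : Base → ℝ, ContDiff ℝ ∞ g → g q = u ∨ g q = v →
      (linearPart c (g q) g q = c.B ↔ linearPart c' (g q) g q = c'.B)) : c = c' := by
  have key : ∀ w : ℝ, w = u ∨ w = v → ∀ β : ℝ, ∀ k : ℕ, k ≠ 0 →
      c.B - w * linearPart c w (monX 0 q) q - β * linearPart c w (monX k q) q
        = c'.B - w * linearPart c' w (monX 0 q) q - β * linearPart c' w (monX k q) q := by
    intro w hw β k hk
    set τ := c.B - w * linearPart c w (monX 0 q) q - β * linearPart c w (monX k q) q with hτ
    have h1 := h (testFun q w τ 0 β k) (contDiff_testFun ..)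
      (by rwa [testFun_self _ _ _ _ _ _ hk])
    rw [testFun_self _ _ _ _ _ _ hk, linearPart_testFun, linearPart_testFun] at h1
    have h2 := h1.1 (by rw [hτ]; ring)
    linarith
  have hlin : ∀ (d : Coeffs r) (w : ℝ) (k : Fin (r + 1)), linearPart d w (monX k q) q
      = d.C * w * (if 1 = (k : ℕ) then ((k : ℕ).factorial : ℝ) else 0)
        - d.A k * (k : ℕ).factorial := by
    intro d w k
    rw [linearPart, dt_monX, dx_monX, Finset.sum_eq_single k]
    · simp [dx_monX]
    · intro j _ hj
      rw [dx_monX, if_neg (fun h => hj (Fin.ext h)), mul_zero]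
    · simp
  have hlin0 : ∀ (d : Coeffs r) (w : ℝ), linearPart d w (monX 0 q) q = -d.A 0 := by
    intro d w
    have := hlin d w 0
    simpa using this
  have h0 : ∀ w : ℝ, w = u ∨ w = v → c.B + w * c.A 0 = c'.B + w * c'.A 0 := by
    intro w hw
    have := key w hw 0 1 one_ne_zero
    rw [hlin0, hlin0] at this
    linarith
  have hk : ∀ w : ℝ, w = u ∨ w = v → ∀ k : Fin (r + 1), (k : ℕ) ≠ 0 →
      c.C * w * (if 1 = (k : ℕ) then ((k : ℕ).factorial : ℝ) else 0)
        - c.A k * (k : ℕ).factorial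
      = c'.C * w * (if 1 = (k : ℕ) then ((k : ℕ).factorial : ℝ) else 0)
        - c'.A k * (k : ℕ).factorial := by
    intro w hw k hk
    have h1 := key w hw 1 k hk
    have h2 := key w hw 0 k hk
    rw [hlin, hlin] at h1
    linarith
  have hA0 : c.A 0 = c'.A 0 := by
    have h1 := h0 u (.inl rfl)
    have h2 := h0 v (.inr rfl)
    refine mul_left_cancel₀ (sub_ne_zero.2 huv) ?_
    linarith
  have hB : c.B = c'.B := by
    have h1 := h0 u (.inl rfl)
    rw [hA0] at h1
    linarith
  have hC : c.C = c'.C := by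
    have h1 := hk u (.inl rfl) ⟨1, by omega⟩ one_ne_zero
    have h2 := hk v (.inr rfl) ⟨1, by omega⟩ one_ne_zero
    simp only [if_true, Nat.factorial_one, Nat.cast_one] at h1 h2
    refine mul_left_cancel₀ (sub_ne_zero.2 huv) ?_
    linarith
  have hA : ∀ k, c.A k = c'.A k := by
    intro k
    by_cases hk0 : k = 0
    · rw [hk0, hA0]
    · have h1 := hk u (.inl rfl) k (fun h => hk0 (Fin.ext h))
      rw [hC] at h1
      exact mul_right_cancel₀ (by positivity) (sub_right_injective h1)
  exact Prod.ext (funext hA) (Prod.ext hB hC)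

theorem IsAdmissible.coeffs_unique (hr : 2 ≤ r) (hP : AreParameters V T X U1 U0)
    (hφ : EqOn φ (fiberAffine T X U1 U0) V) {θ θ' θ'' : Base → Coeffs r}
    (h' : IsAdmissible r V θ θ' φ) (h'' : IsAdmissible r V θ θ'' φ) {p : Total} (hp : p ∈ V) :
    θ' (φ p).1 = θ'' (φ p).1 := by
  have hV := h'.1.1
  obtain ⟨b, u⟩ := p
  have hb : b ∈ Prod.fst '' V := ⟨_, hp, rfl⟩
  obtain ⟨n1, n2, n3⟩ := hP.ne_zero hV hb
  have e : ∀ v, (b, v) ∈ V → φ (b, v) = ((T b.1, X b), U1 b.1 * v + U0 b) := fun v hv => by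
    rw [hφ hv]; rfl
  -- Openness of `V` supplies a second value of `u` over the same base point; its image differs
  -- because `U1 ≠ 0`.
  obtain ⟨v, hv, huv⟩ : ∃ v, (b, v) ∈ V ∧ u ≠ v := by
    have h1 : ContinuousAt (fun v : ℝ => ((b, v) : Total)) u := by fun_prop
    have h2 := (h1.eventually (hV.mem_nhds hp)).filter_mono (nhdsWithin_le_nhds (s := {u}ᶜ))
    obtain ⟨v, hv1, hv2⟩ := (h2.and self_mem_nhdsWithin).exists
    exact ⟨v, hv1, fun h => hv2 h.symm⟩
  rw [e u hp]
  refine coeffs_eq_of_linearPart_iff hr (q := (T b.1, X b)) (u := U1 b.1 * u + U0 b)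
    (v := U1 b.1 * v + U0 b) (fun h => huv (mul_left_cancel₀ n3 (add_right_cancel h))) ?_
  intro g hg hgq
  -- Any target function passing through one of the two image points is the image of this
  -- pulled-back function, so both target equations are tested against the same source equation.
  have hsm : ContDiffOn ℝ ∞ (fun a => (g (T a.1, X a) - U0 a) / U1 a.1) (Prod.fst '' V) :=
    ((hg.comp_contDiffOn (hP.contDiffOn_fst.1.prodMk hP.2.1)).sub hP.2.2.2.1).div
      hP.contDiffOn_fst.2 fun a ha => (hP.ne_zero hV ha).2.2
  obtain ⟨f, hf, hfe⟩ := exists_contDiff_eventuallyEq (isOpen_base hV) hb hsm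
  have hfb : f b = (g (T b.1, X b) - U0 b) / U1 b.1 := hfe.self_of_nhds
  have hfV : (b, f b) ∈ V := by
    rw [hfb]
    rcases hgq with h | h <;> rw [h, add_sub_cancel_right, mul_div_cancel_left₀ _ n3] <;>
      assumption
  have hpair : IsPaired φ f g b := by
    have hcont : ContinuousAt (fun a => ((a, f a) : Total)) b :=
      (continuous_id.prodMk hf.continuous).continuousAt
    refine ⟨hf, hg, ?_⟩
    filter_upwards [hfe, hcont.eventually (hV.mem_nhds hfV)] with a h1 h2
    have h3 := (hP.ne_zero hV (b := a) ⟨_, h2, rfl⟩).2.2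
    rw [hφ h2]
    change U1 a.1 * f a + U0 a = g (T a.1, X a)
    rw [h1]
    field_simp
    ring
  have h1 := h'.2.2.2.linearPart_iff (by omega) hpair hfV
  have h2 := h''.2.2.2.linearPart_iff (by omega) hpair hfV
  have h3 := hpair.2.2.self_of_nhds
  rw [h3, e _ hfV] at h1 h2
  exact h1.symm.trans h2

theorem AreParameters.isEquivalenceTransformation (hr : 2 ≤ r) (hV : IsOpen V) (hc : Convex ℝ V)
    (hP : AreParameters V T X U1 U0) (hφ : EqOn φ (fiberAffine T X U1 U0) V) :
    IsEquivalenceTransformation r V φ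
      fun z => (φ z.1, pushCoeffs T X U1 U0 z.1.1 z.2) := by
  refine ⟨hP.isPointTransformation hV hc hφ, hP.isPointTransformation_joint hV hc hφ,
    fun _ _ _ _ => rfl, fun V' hV' hs θ hθ => ?_⟩
  obtain ⟨θ', h1, h2⟩ := hP.isAdmissible hr hV hc hφ hV' hs hθ
  exact ⟨θ', h1, fun p hp => by rw [h2 p hp]⟩

end parameters

/-! ### Normalization and the final assembly. -/

theorem isNormalizedInUsualSense {r : ℕ} (hr : 2 ≤ r) : IsNormalizedInUsualSense r := by
  intro W φ hpt θ θ'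
  constructor
  · intro h V hV hc hs
    have hadm := h.mono hV hs
    obtain ⟨T, X, U1, U0, hP, hφ⟩ := hadm.exists_eqOn_fiberAffine hr hc
    have hΦ := hP.isEquivalenceTransformation hr hV hc hφ
    refine ⟨hadm.2.1, _, hΦ, ?_⟩
    obtain ⟨θ'', h1, h2⟩ := hΦ.2.2.2 V hV subset_rfl θ hadm.2.1
    intro p hp
    rw [h2 p hp, IsAdmissible.coeffs_unique hr hP hφ hadm h1 hp]
  · intro h
    -- Admissibility is a local property, so it suffices to check it on balls, which are convex.
    have hloc : ∀ p ∈ W, ∃ V, IsOpen V ∧ p ∈ V ∧ V ⊆ W ∧ IsAdmissible r V θ θ' φ := by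
      intro p hp
      obtain ⟨ε, hε, hεW⟩ := Metric.isOpen_iff.1 hpt.1 p hp
      refine ⟨Metric.ball p ε, Metric.isOpen_ball, Metric.mem_ball_self hε, hεW, ?_⟩
      obtain ⟨hθ, Φ, hΦ, hcar⟩ := h _ Metric.isOpen_ball (convex_ball p ε) hεW
      obtain ⟨θ'', h1, h2⟩ := hΦ.2.2.2 _ Metric.isOpen_ball subset_rfl θ hθ
      have heq : ∀ z ∈ Metric.ball p ε, θ' (φ z).1 = θ'' (φ z).1 := fun z hz =>
        congrArg Prod.snd ((hcar z hz).symm.trans (h2 z hz))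
      refine ⟨h1.1, hθ, ⟨h1.2.2.1.1.congr ?_, ?_⟩, ?_⟩
      · rintro _ ⟨_, ⟨z, hz, rfl⟩, rfl⟩
        exact heq z hz
      · rintro _ ⟨_, ⟨z, hz, rfl⟩, rfl⟩
        rw [heq z hz]
        exact h1.regular_right hz
      · rintro j j' ⟨f, g, b, hf, hg, hb, he, rfl, rfl⟩
        have h3 := h1.2.2.2 _ _ ⟨f, g, b, hf, hg, hb, he, rfl, rfl⟩
        rw [h3, jet_mem_equation_iff (by omega), jet_mem_equation_iff (by omega), heq _ hb]
    refine ⟨hpt, ⟨?_, ?_⟩, ⟨?_, ?_⟩, ?_⟩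
    · rintro _ ⟨p, hp, rfl⟩
      obtain ⟨V, hV, hpV, -, hadm⟩ := hloc p hp
      exact (hadm.2.1.1.contDiffAt ((isOpen_base hV).mem_nhds
        (mem_image_of_mem _ hpV))).contDiffWithinAt
    · rintro _ ⟨p, hp, rfl⟩
      obtain ⟨V, hV, hpV, -, hadm⟩ := hloc p hp
      exact hadm.regular_left hpV
    · rintro _ ⟨_, ⟨p, hp, rfl⟩, rfl⟩
      obtain ⟨V, hV, hpV, hVW, hadm⟩ := hloc p hp
      -- Openness of the image upgrades smoothness of `θ'` on the image of `V` to smoothness at the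
      -- point, hence on the image of `W`.
      have hO : IsOpen (φ '' V) := by
        rw [isOpen_iff_mem_nhds]
        rintro _ ⟨z, hz, rfl⟩
        obtain ⟨N, χ, hN, hzN, -, hχ, -⟩ :=
          exists_contDiffOn_localInverse hV hz hadm.1.2.1 (hadm.1.2.2.2 z hz)
        exact mem_of_superset (hN.mem_nhds hzN) fun q hq => ⟨χ q, hχ q hq⟩
      exact (hadm.2.2.1.1.contDiffAt ((isOpen_base hO).mem_nhds
        (mem_image_of_mem _ (mem_image_of_mem _ hpV)))).contDiffWithinAt
    · rintro _ ⟨_, ⟨p, hp, rfl⟩, rfl⟩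
      obtain ⟨V, hV, hpV, -, hadm⟩ := hloc p hp
      exact hadm.regular_right hpV
    · rintro j j' ⟨f, g, b, hf, hg, hb, he, hj, hj'⟩
      obtain ⟨V, hV, hpV, -, hadm⟩ := hloc _ hb
      exact hadm.2.2.2 j j' ⟨f, g, b, hf, hg, hpV, he, hj, hj'⟩

theorem exists_mem_regular (r : ℕ) : ∃ c : Coeffs r, c ∈ regular r :=
  ⟨(fun _ => 1, 0, 1), by simp [regular, Coeffs.C, Coeffs.A]⟩

end BurgersKdV

theorem mainTheorem2 (r : ℕ) (hr : 2 ≤ r) :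
    BurgersKdV.IsNormalizedInUsualSense r ∧
    (∀ (W : Set BurgersKdV.Total) (φ : BurgersKdV.Total → BurgersKdV.Total)
      (Φ : BurgersKdV.Total × BurgersKdV.Coeffs r → BurgersKdV.Total × BurgersKdV.Coeffs r),
      BurgersKdV.IsEquivalenceTransformation r W φ Φ →
      ∀ V : Set BurgersKdV.Total, IsOpen V → Convex ℝ V → V ⊆ W →
        ∃ (T : ℝ → ℝ) (X : BurgersKdV.Base → ℝ) (U1 : ℝ → ℝ) (U0 : BurgersKdV.Base → ℝ),
          BurgersKdV.AreParameters V T X U1 U0 ∧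
          Set.EqOn φ (BurgersKdV.fiberAffine T X U1 U0) V) ∧
    (∀ V : Set BurgersKdV.Total, IsOpen V → Convex ℝ V →
      ∀ (T : ℝ → ℝ) (X : BurgersKdV.Base → ℝ) (U1 : ℝ → ℝ) (U0 : BurgersKdV.Base → ℝ),
        BurgersKdV.AreParameters V T X U1 U0 →
        ∀ φ : BurgersKdV.Total → BurgersKdV.Total,
          Set.EqOn φ (BurgersKdV.fiberAffine T X U1 U0) V →
          ∃ Φ : BurgersKdV.Total × BurgersKdV.Coeffs r →
              BurgersKdV.Total × BurgersKdV.Coeffs r,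
            BurgersKdV.IsEquivalenceTransformation r V φ Φ ∧
            ∀ Φ' : BurgersKdV.Total × BurgersKdV.Coeffs r →
                BurgersKdV.Total × BurgersKdV.Coeffs r,
              BurgersKdV.IsEquivalenceTransformation r V φ Φ' →
              Set.EqOn Φ' Φ (V ×ˢ BurgersKdV.regular r)) := by
  refine ⟨BurgersKdV.isNormalizedInUsualSense hr, ?_, ?_⟩
  · intro W φ Φ hΦ V hV hc hs
    obtain ⟨c, hreg⟩ := BurgersKdV.exists_mem_regular r
    obtain ⟨θ', hadm, -⟩ := hΦ.2.2.2 V hV hs _ (BurgersKdV.isArbitraryElement_const _ hreg)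
    exact hadm.exists_eqOn_fiberAffine hr hc
  · intro V hV hc T X U1 U0 hP φ hφ
    have hΦ := hP.isEquivalenceTransformation hr hV hc hφ
    refine ⟨_, hΦ, ?_⟩
    -- Every regular value `c` is attained by a constant tuple, so the values of `Φ` and `Φ'` at
    -- `(p, c)` are fixed by the target coefficients of that one equation.
    rintro Φ' hΦ' ⟨p, c⟩ ⟨hp, hreg⟩
    have hθ := BurgersKdV.isArbitraryElement_const (Prod.fst '' V) hreg
    obtain ⟨θ', h1, h2⟩ := hΦ.2.2.2 V hV subset_rfl _ hθ
    obtain ⟨θ'', h3, h4⟩ := hΦ'.2.2.2 V hV subset_rfl _ hθ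
    have h5 := BurgersKdV.IsAdmissible.coeffs_unique hr hP hφ h3 h1 hp
    exact (h4 p hp).trans ((congrArg (Prod.mk (φ p)) h5).trans (h2 p hp).symm)
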